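/- Let $\mathbb T=\mathbb R/2\pi\mathbb Z$; functions on $\mathbb T$ are identified with $2\pi$-periodic functions on $\mathbb R$, and elements of $W^{1,\infty}(\mathbb T)$ with their continuous representatives. For $u\in W^{1,\infty}(\mathbb T)$ write $u''+u\ge 0$ if $\int_{\mathbb T}(uv-u'v')\,d\theta\ge 0$ for every $v\in W^{1,\infty}(\mathbb T)$ with $v\ge 0$. Let $k_1,k_2:\mathbb T\to[0,\infty]$ be upper and lower semicontinuous, respectively, and let $$\mathcal F_{ad}=\{u\in W^{1,\infty}(\mathbb T):\ k_1\le u\le k_2,\ u>0\}.$$ Let $r:W^{1,\infty}(\mathbb T)\to\mathbb R$, $G:\mathbb T\times(0,\infty)\times\mathbb R\to\mathbb R$, $(\theta,u,q)\mapsto G(\theta,u,q)$, and $$j(u)=r(u)+\int_{\mathbb T}G(\theta,u(\theta),u'(\theta))\,d\theta$$ for those $u\in W^{1,\infty}(\mathbb T)$, $u>0$, for which the integral exists. Let $u_0$ minimize $j$ over all $u\in\mathcal F_{ad}$ with $u''+u\ge0$ for which $j(u)$ is defined. Let $\mathrm{Conv}(u_0'(\mathbb T))$ be the smallest closed interval containing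 all left and right derivatives $u_0'(\theta^-),u_0'(\theta^+)$, $\theta\in\mathbb T$, and put $S=\mathbb T\times u_0(\mathbb T)\times\mathrm{Conv}(u_0'(\mathbb T))$. Assume that 1. $r$ is $C^1$ (for the $W^{1,\infty}(\mathbb T)$ norm) in a neighbourhood of $u_0$, and $G$ is $C^2$ in a neighbourhood of $S$; 2. $r'(u_0)\in L^p(\mathbb T)$ for some $p\in[1,\infty]$, i.e. there is $g\in L^p(\mathbb T)$ with $r'(u_0)v=\int_{\mathbb T}gv\,d\theta$ for all $v\in W^{1,\infty}(\mathbb T)$; 3. $G_{qq}>0$ on $S$. Then $u_0\in W^{2,p}(\mathbb T_{in})$, where $\mathbb T_{in}=\{\theta\in\mathbb T:\ k_1(\theta)<u_0(\theta)<k_2(\theta)\}$ (an open set). -/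

import Mathlib

open MeasureTheory Set Filter Topology
open scoped ENNReal NNReal ContDiff

noncomputable section

namespace GaugeReg

/-! Functions on the circle `𝕋 = ℝ / 2πℤ` are represented throughout by `2π`-periodic functions on
`ℝ`, and subsets of `𝕋` by their `2π`-periodic preimages in `ℝ`. -/

/-- The locally integrable function `g` is the weak derivative of the locally integrable function
`f` on the open set `Ω ⊆ ℝ`: `∫ f φ' = - ∫ g φ` for all `φ ∈ C_c^∞(Ω)`. -/
def HasWeakDerivOn (Ω : Set ℝ) (f g : ℝ → ℝ) : Prop :=
  LocallyIntegrableOn f Ω ∧ LocallyIntegrableOn g Ω ∧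
    ∀ φ : ℝ → ℝ, ContDiff ℝ ∞ φ → HasCompactSupport φ → tsupport φ ⊆ Ω →
      ∫ θ, f θ * deriv φ θ = - ∫ θ, g θ * φ θ

/-- `W^{2,p}(Ω)` for an open subset `Ω` of the circle. As `Ω ⊆ ℝ` is the periodic preimage, the weak
derivatives (a local notion) are taken on all of `Ω`, while the `L^p` norms are taken over one
period. -/
def MemW2 (p : ℝ≥0∞) (Ω : Set ℝ) (f : ℝ → ℝ) : Prop :=
  ∃ f₁ f₂ : ℝ → ℝ,
    HasWeakDerivOn Ω f f₁ ∧ HasWeakDerivOn Ω f₁ f₂ ∧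
    MemLp f p (volume.restrict (Ω ∩ Ico 0 (2 * Real.pi))) ∧
    MemLp f₁ p (volume.restrict (Ω ∩ Ico 0 (2 * Real.pi))) ∧
    MemLp f₂ p (volume.restrict (Ω ∩ Ico 0 (2 * Real.pi)))

/-- `u` is (the continuous representative of) an element of `W^{1,∞}(𝕋)`: it is `2π`-periodic and
has an essentially bounded weak derivative on `ℝ`. (By periodicity, `u` itself is bounded, and local
and global boundedness of the derivative are the same.) -/
def MemW1 (u : ℝ → ℝ) : Prop :=
  Continuous u ∧ Function.Periodic u (2 * Real.pi) ∧
    ∃ g : ℝ → ℝ, MemLp g ∞ volume ∧ HasWeakDerivOn univ u g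

/-! ### Elements of `W^{1,∞}` are the Lipschitz functions -/

theorem lipschitz_of_weakDeriv {f g : ℝ → ℝ} {C : ℝ≥0} (hf : Continuous f)
    (hg : ∀ᵐ x, ‖g x‖ ≤ C) (hw : HasWeakDerivOn univ f g) : LipschitzWith C f := by
  let ρ : ℕ → ContDiffBump (0 : ℝ) := fun n =>
    ⟨1 / (2 * ((n : ℝ) + 1)), 1 / ((n : ℝ) + 1), by positivity, by
      apply one_div_lt_one_div_of_lt <;> nlinarith [(Nat.cast_nonneg n : (0 : ℝ) ≤ n)]⟩
  have hρ : Tendsto (fun n => (ρ n).rOut) atTop (𝓝 0) := tendsto_one_div_add_atTop_nhds_zero_nat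
  let F : ℕ → ℝ → ℝ := fun n =>
    convolution ((ρ n).normed volume) f (ContinuousLinearMap.lsmul ℝ ℝ) volume
  have hlim : ∀ x, Tendsto (fun n => F n x) atTop (𝓝 (f x)) := fun x =>
    ContDiffBump.convolution_tendsto_right_of_continuous hρ hf x
  have hder : ∀ n x, ∃ d : ℝ, HasDerivAt (F n) d x ∧ ‖d‖ ≤ C := by
    intro n x
    have hsm : ContDiff ℝ ∞ ((ρ n).normed volume) := (ρ n).contDiff_normed
    have hcs : HasCompactSupport ((ρ n).normed volume) := (ρ n).hasCompactSupport_normed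
    have h1 := hcs.hasDerivAt_convolution_left (ContinuousLinearMap.lsmul ℝ ℝ)
      (hsm.of_le (by exact_mod_cast le_top)) hf.locallyIntegrable (μ := volume) x
    refine ⟨_, h1, ?_⟩
    rw [convolution_eq_swap]
    simp only [ContinuousLinearMap.lsmul_apply, smul_eq_mul]
    set φ : ℝ → ℝ := fun s => (ρ n).normed volume (x - s) with hφ
    have hφs : ContDiff ℝ ∞ φ := hsm.comp (contDiff_const.sub contDiff_id)
    have hφc : HasCompactSupport φ := hcs.comp_homeomorph (Homeomorph.subLeft x)
    have hφd : ∀ s, deriv φ s = - deriv ((ρ n).normed volume) (x - s) := by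
      intro s
      exact deriv_comp_const_sub _ _ _
    have hint : ∫ s, φ s = 1 := by
      rw [hφ, integral_sub_left_eq_self (fun s => (ρ n).normed volume s) volume x]
      exact (ρ n).integral_normed
    have h2 := hw.2.2 φ hφs hφc (subset_univ _)
    have h3 : ∫ t, deriv ((ρ n).normed volume) (x - t) * f t = ∫ t, g t * φ t := by
      have : ∀ t, deriv ((ρ n).normed volume) (x - t) * f t = - (f t * deriv φ t) := by
        intro t; rw [hφd]; ring
      simp_rw [this, integral_neg, h2, neg_neg]
    rw [h3]
    have h4 : ‖∫ t, g t * φ t‖ ≤ ∫ t, C * φ t := by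
      apply norm_integral_le_of_norm_le
      · exact (hφs.continuous.integrable_of_hasCompactSupport hφc).const_mul _
      · filter_upwards [hg] with t ht
        have h0 : 0 ≤ φ t := (ρ n).nonneg_normed _
        rw [norm_mul, Real.norm_of_nonneg h0]
        exact mul_le_mul_of_nonneg_right ht h0
    rwa [integral_const_mul, hint, mul_one] at h4
  have hlip : ∀ n, LipschitzWith C (F n) := by
    intro n
    apply lipschitzWith_of_nnnorm_deriv_le (𝕜 := ℝ)
    · intro x
      obtain ⟨d, hd, _⟩ := hder n x
      exact hd.differentiableAt
    · intro x
      obtain ⟨d, hd, hC⟩ := hder n x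
      rw [hd.deriv]
      exact_mod_cast hC
  refine LipschitzWith.of_dist_le_mul fun x y => ?_
  exact le_of_tendsto ((hlim x).dist (hlim y))
    (Eventually.of_forall fun n => (hlip n).dist_le_mul x y)

theorem memLp_deriv_of_lipschitz {f : ℝ → ℝ} {C : ℝ≥0} (hf : LipschitzWith C f) :
    MemLp (deriv f) (⊤ : ℝ≥0∞) volume :=
  memLp_top_of_bound (measurable_deriv f).aestronglyMeasurable C
    (Eventually.of_forall fun _ => norm_deriv_le_of_lipschitz hf)

/-- The pointwise derivative of a Lipschitz function is its weak derivative. -/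
theorem hasWeakDerivOn_of_lipschitz {f : ℝ → ℝ} {C : ℝ≥0} (hf : LipschitzWith C f) :
    HasWeakDerivOn univ f (deriv f) := by
  refine ⟨hf.continuous.locallyIntegrable.locallyIntegrableOn _,
    ((memLp_deriv_of_lipschitz hf).locallyIntegrable le_top).locallyIntegrableOn _, ?_⟩
  intro φ hφ hφc _
  obtain ⟨D, hD⟩ := hφ.lipschitzWith_of_hasCompactSupport hφc (by simp)
  have h := hf.integral_lineDeriv_mul_eq hD hφc (μ := volume) (1 : ℝ)
  have e1 : ∀ x, lineDeriv ℝ f x 1 = deriv f x := by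
    intro x
    simp [lineDeriv, deriv_comp_const_add]
  have e2 : ∀ x, lineDeriv ℝ φ x (-1) = - deriv φ x := by
    intro x
    rw [lineDeriv_neg]
    simp [lineDeriv, deriv_comp_const_add]
  simp_rw [e1, e2] at h
  rw [h, ← integral_neg]
  congr 1
  ext x
  ring

theorem memW1_iff {u : ℝ → ℝ} :
    MemW1 u ↔ Function.Periodic u (2 * Real.pi) ∧ ∃ C : ℝ≥0, LipschitzWith C u := by
  constructor
  · rintro ⟨hc, hp, g, hg, hw⟩
    refine ⟨hp, (eLpNorm g ∞ volume).toNNReal, lipschitz_of_weakDeriv hc ?_ hw⟩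
    filter_upwards [ae_le_eLpNormEssSup (f := g) (μ := volume)] with x hx
    have hfin : eLpNorm g (⊤ : ℝ≥0∞) volume ≠ (⊤ : ℝ≥0∞) := hg.2.ne
    rw [eLpNorm_exponent_top] at hfin ⊢
    have := ENNReal.toNNReal_mono hfin hx
    exact_mod_cast this
  · rintro ⟨hp, C, hC⟩
    exact ⟨hC.continuous, hp, deriv u, memLp_deriv_of_lipschitz hC, hasWeakDerivOn_of_lipschitz hC⟩

/-! ### The normed space `W^{1,∞}(𝕋)` -/

/-- `W^{1,∞}(𝕋)` as a space of functions. -/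
def W1Sub : Submodule ℝ (ℝ → ℝ) where
  carrier := {u | MemW1 u}
  zero_mem' := memW1_iff.2 ⟨fun _ => rfl, 0, LipschitzWith.const 0⟩
  add_mem' := by
    intro a b ha hb
    obtain ⟨hpa, A, hA⟩ := memW1_iff.1 ha
    obtain ⟨hpb, B, hB⟩ := memW1_iff.1 hb
    exact memW1_iff.2 ⟨hpa.add hpb, A + B, hA.add hB⟩
  smul_mem' := by
    intro c a ha
    obtain ⟨hpa, A, hA⟩ := memW1_iff.1 ha
    exact memW1_iff.2 ⟨hpa.smul c, ‖c‖₊ * A, (lipschitzWith_smul c).comp hA⟩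

/-- The space `W^{1,∞}(𝕋)`, which carries the norm `‖u‖_{L^∞} + ‖u'‖_{L^∞}` below (and not
the topology of pointwise convergence). -/
def W1 : Type := ↥W1Sub

instance : AddCommGroup W1 := inferInstanceAs (AddCommGroup ↥W1Sub)

instance : Module ℝ W1 := inferInstanceAs (Module ℝ ↥W1Sub)

/-- The function `ℝ → ℝ` underlying an element of `W^{1,∞}(𝕋)`. -/
def W1.toFun (u : W1) : ℝ → ℝ := Subtype.val (p := fun f => f ∈ W1Sub) u

instance : CoeFun W1 (fun _ => ℝ → ℝ) := ⟨W1.toFun⟩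

theorem W1.memW1 (u : W1) : MemW1 u := Subtype.property (p := fun f => f ∈ W1Sub) u

theorem W1.coe_add (u v : W1) : ((u + v : W1) : ℝ → ℝ) = fun θ => u θ + v θ := rfl

theorem W1.coe_smul (c : ℝ) (u : W1) : ((c • u : W1) : ℝ → ℝ) = fun θ => c * u θ := rfl

theorem W1.coe_neg (u : W1) : ((-u : W1) : ℝ → ℝ) = fun θ => - u θ := rfl

theorem W1.coe_zero : ((0 : W1) : ℝ → ℝ) = fun _ => 0 := rfl

theorem W1.ext {u v : W1} (h : ∀ θ, u θ = v θ) : u = v := Subtype.ext (funext h)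

theorem W1.continuous (u : W1) : Continuous u := u.memW1.1

theorem W1.ae_differentiableAt (u : W1) : ∀ᵐ θ, DifferentiableAt ℝ u θ := by
  obtain ⟨_, C, hC⟩ := memW1_iff.1 u.memW1
  exact hC.ae_differentiableAt

theorem W1.memLp (u : W1) : MemLp u ∞ volume := by
  obtain ⟨M, hM⟩ := (isCompact_Icc (a := (0 : ℝ)) (b := 0 + 2 * Real.pi)).exists_bound_of_continuousOn
    u.continuous.continuousOn
  refine memLp_top_of_bound u.continuous.aestronglyMeasurable M (Eventually.of_forall fun x => ?_)
  obtain ⟨y, hy, hxy⟩ := u.memW1.2.1.exists_mem_Ico (by positivity) x 0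
  rw [hxy]
  exact hM y (Ico_subset_Icc_self hy)

theorem W1.memLp_deriv (u : W1) : MemLp (deriv u) ∞ volume := by
  obtain ⟨_, C, hC⟩ := memW1_iff.1 u.memW1
  exact memLp_deriv_of_lipschitz hC

/-- `‖u‖_{W^{1,∞}(𝕋)} = ‖u‖_{L^∞} + ‖u'‖_{L^∞}`. -/
def W1.normFun : AddGroupNorm W1 where
  toFun u := (eLpNorm u ∞ volume).toReal + (eLpNorm (deriv u) ∞ volume).toReal
  map_zero' := by
    have h1 : ((0 : W1) : ℝ → ℝ) = 0 := rfl
    have h2 : deriv ((0 : W1) : ℝ → ℝ) = 0 := by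
      rw [h1]; ext θ; simp
    rw [h2, h1, eLpNorm_zero, ENNReal.toReal_zero, add_zero]
  add_le' u v := by
    have h1 : eLpNorm ((u + v : W1) : ℝ → ℝ) ∞ volume ≤ eLpNorm u ∞ volume + eLpNorm v ∞ volume :=
      eLpNorm_add_le u.memLp.1 v.memLp.1 le_top
    have hd : deriv ((u + v : W1) : ℝ → ℝ) =ᵐ[volume] deriv u + deriv v := by
      filter_upwards [u.ae_differentiableAt, v.ae_differentiableAt] with θ hu hv
      rw [W1.coe_add, deriv_fun_add hu hv, Pi.add_apply]
    have h2 : eLpNorm (deriv ((u + v : W1) : ℝ → ℝ)) ∞ volume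
        ≤ eLpNorm (deriv u) ∞ volume + eLpNorm (deriv v) ∞ volume := by
      rw [eLpNorm_congr_ae hd]
      exact eLpNorm_add_le u.memLp_deriv.1 v.memLp_deriv.1 le_top
    have h3 := ENNReal.toReal_mono (ENNReal.add_ne_top.2 ⟨u.memLp.2.ne, v.memLp.2.ne⟩) h1
    have h4 := ENNReal.toReal_mono
      (ENNReal.add_ne_top.2 ⟨u.memLp_deriv.2.ne, v.memLp_deriv.2.ne⟩) h2
    rw [ENNReal.toReal_add u.memLp.2.ne v.memLp.2.ne] at h3
    rw [ENNReal.toReal_add u.memLp_deriv.2.ne v.memLp_deriv.2.ne] at h4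
    linarith
  neg' u := by
    have h1 : ((-u : W1) : ℝ → ℝ) = - (u : ℝ → ℝ) := rfl
    have h2 : deriv ((-u : W1) : ℝ → ℝ) = - deriv (u : ℝ → ℝ) := by
      rw [h1]; ext θ; simp
    rw [h2, h1, eLpNorm_neg, eLpNorm_neg]
  eq_zero_of_map_eq_zero' u hu := by
    have h1 : (eLpNorm u ∞ volume).toReal = 0 := by
      have := ENNReal.toReal_nonneg (a := eLpNorm u ∞ volume)
      have := ENNReal.toReal_nonneg (a := eLpNorm (deriv u) ∞ volume)
      linarith
    rw [ENNReal.toReal_eq_zero_iff, or_iff_left u.memLp.2.ne,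
      eLpNorm_eq_zero_iff u.memLp.1 (by simp)] at h1
    have h2 : (u : ℝ → ℝ) = 0 := u.continuous.ae_eq_iff_eq volume continuous_zero |>.1 h1
    exact W1.ext fun θ => congrFun h2 θ

instance : NormedAddCommGroup W1 := W1.normFun.toNormedAddCommGroup

theorem W1.norm_def (u : W1) :
    ‖u‖ = (eLpNorm u ∞ volume).toReal + (eLpNorm (deriv u) ∞ volume).toReal := rfl

instance : NormedSpace ℝ W1 where
  norm_smul_le c u := by
    have h1 : ((c • u : W1) : ℝ → ℝ) = c • (u : ℝ → ℝ) := rfl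
    have h2 : deriv ((c • u : W1) : ℝ → ℝ) = c • deriv (u : ℝ → ℝ) := by
      rw [h1]; ext θ; exact deriv_const_smul_field c (u : ℝ → ℝ)
    rw [W1.norm_def, W1.norm_def, h2, h1, eLpNorm_const_smul, eLpNorm_const_smul]
    simp [mul_add]

/-! ### The minimization problem -/

/-- `u'' + u ≥ 0`, i.e. `∫_𝕋 (u v - u' v') ≥ 0` for all nonnegative `v ∈ W^{1,∞}(𝕋)`. -/
def IsConvexGauge (u : W1) : Prop :=
  ∀ v : W1, (∀ θ, 0 ≤ v θ) →
    0 ≤ ∫ θ in (0 : ℝ)..(2 * Real.pi), (u θ * v θ - deriv u θ * deriv v θ)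

/-- The set `{u ∈ W^{1,∞}(𝕋) : k₁ ≤ u ≤ k₂ and u > 0}`. -/
def Fad (k₁ k₂ : ℝ → ℝ≥0∞) : Set W1 :=
  {u | ∀ θ, k₁ θ ≤ ENNReal.ofReal (u θ) ∧ ENNReal.ofReal (u θ) ≤ k₂ θ ∧ 0 < u θ}

/-- The set `𝕋_in` where the inclusion constraints are not saturated. -/
def Tin (k₁ k₂ : ℝ → ℝ≥0∞) (u : W1) : Set ℝ :=
  {θ | k₁ θ < ENNReal.ofReal (u θ) ∧ ENNReal.ofReal (u θ) < k₂ θ}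

/-- The integrand `θ ↦ G(θ, u(θ), u'(θ))`. -/
def integrand (G : ℝ × ℝ × ℝ → ℝ) (u : W1) (θ : ℝ) : ℝ := G (θ, u θ, deriv u θ)

/-- The functional `j(u) = r(u) + ∫_𝕋 G(θ, u, u') dθ`. -/
def energy (r : W1 → ℝ) (G : ℝ × ℝ × ℝ → ℝ) (u : W1) : ℝ :=
  r u + ∫ θ in (0 : ℝ)..(2 * Real.pi), integrand G u θ

/-- `u₀` minimizes `j` over `{u ∈ F_ad : u'' + u ≥ 0}`. Competitors are those for which `j(u)` is
defined, i.e. for which the integral exists. -/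
def IsOptimal (r : W1 → ℝ) (G : ℝ × ℝ × ℝ → ℝ) (k₁ k₂ : ℝ → ℝ≥0∞) (u₀ : W1) : Prop :=
  u₀ ∈ Fad k₁ k₂ ∧ IsConvexGauge u₀ ∧
    IntervalIntegrable (integrand G u₀) volume 0 (2 * Real.pi) ∧
    ∀ u ∈ Fad k₁ k₂, IsConvexGauge u →
      IntervalIntegrable (integrand G u) volume 0 (2 * Real.pi) →
      energy r G u₀ ≤ energy r G u

/-- `Conv(u'(𝕋))`: the smallest closed interval containing all one-sided derivatives of `u`. -/
def convDeriv (u : W1) : Set ℝ :=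
  closure (convexHull ℝ {q | ∃ θ, HasDerivWithinAt u q (Ioi θ) θ ∨ HasDerivWithinAt u q (Iio θ) θ})

/-- `𝕋 × u(𝕋) × Conv(u'(𝕋))`. -/
def graphBox (u : W1) : Set (ℝ × ℝ × ℝ) := univ ×ˢ (range u ×ˢ convDeriv u)

end GaugeReg

end

/-! The proof rests on one family of competitors. With `u` the gauge function of a planar convex body,
the function `w` with `w'' + w = 0` and `w = u` at two nearby angles `a < b` is the line through two
boundary points, and `max u w` is the gauge function of the body with the cap between them cut off;
so `v = max (w - u) 0` (`cap`) is nonnegative and supported in `[a, b]`, and `u + t v` keeps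
`u'' + u ≥ 0` for `0 ≤ t ≤ 1` (`isConvexGauge_add_smul_cap`). Only the constraint `u ≤ k₂` can be
violated, and not for small `t` if `[a, b]` lies in `𝕋_in`. Hence `0 ≤ j'(u) v`
(`IsOptimal.first_variation`), that is, `0 ≤ ∫ γ v + G_u v + G_q v'` with `γ` the density of `r'(u)`.

On `[a, b]` one has `v' = w' - u'`, where `w'` is within `O(b - a)` of the mean `k` of `u'`. As `v'`
has integral zero, `G_q(θ, u, u')` may be replaced by its difference to the constant
`G_q(a, u(a), k)`, and `G_qq ≥ c > 0` turns `G_q v'` into `-c (u' - k)²` up to lower order terms. The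
outcome (`integral_sq_le_of_variation`) is

  `∫_a^b (u' - k)² ≤ C (b - a) (∫_a^b (1 + |γ|))²`.

Since `u'' ≥ -u ≥ -M` for an upper bound `M` of `u`, `u' + M θ` agrees almost everywhere with a
monotone function `F` (`IsConvexGauge.exists_monotone`). For a monotone function, mean square
oscillation over an interval bounds the increment over its middle third
(`increment_le_of_excess`), and fine subdivisions, whose enlarged pieces overlap three times, give
`F y - F x ≤ C ∫_x^y (1 + |γ|)` whenever `[x, y] ⊆ 𝕋_in` (`increment_le_of_local`). So `u'` is locally
absolutely continuous on `𝕋_in`, and by Lebesgue differentiation `|u''| ≤ C (1 + |γ|)` there. This is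
the `L^p` bound, with no loss at `p = 1`.

The argument uses `u'' + u ≥ 0` through trigonometric convexity: it is equivalent to
`2 cos h · u(x) ≤ u(x + h) + u(x - h)` for small `h` (`IsConvexGauge.midpoint` and
`isConvexGauge_of_midpoint`), a condition that is stable under maxima. -/

namespace GaugeReg

/-! ### Periodic Lipschitz functions -/

/-- The element of `W^{1,∞}(𝕋)` given by a function with the defining property. -/
def W1.of (f : ℝ → ℝ) (hf : MemW1 f) : W1 := (⟨f, hf⟩ : ↥W1Sub)

@[simp] theorem W1.of_apply (f : ℝ → ℝ) (hf : MemW1 f) : (W1.of f hf : ℝ → ℝ) = f := rfl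

theorem W1.periodic (u : W1) : Function.Periodic u (2 * Real.pi) := u.memW1.2.1

theorem W1.exists_lipschitz (u : W1) : ∃ C : ℝ≥0, LipschitzWith C u := (memW1_iff.1 u.memW1).2

theorem W1.absolutelyContinuous (u : W1) (a b : ℝ) : AbsolutelyContinuousOnInterval u a b := by
  obtain ⟨C, hC⟩ := u.exists_lipschitz
  exact (hC.lipschitzOnWith (s := uIcc a b)).absolutelyContinuousOnInterval

theorem periodic_deriv {f : ℝ → ℝ} {T : ℝ} (hf : Function.Periodic f T) :
    Function.Periodic (deriv f) T := by
  intro x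
  rw [← deriv_comp_add_const f T x]
  congr 1
  exact funext hf

theorem W1.intervalIntegrable_deriv_mul (u v : W1) (a b : ℝ) :
    IntervalIntegrable (fun θ => deriv u θ * deriv v θ) volume a b := by
  have h : MemLp (fun θ => deriv u θ * deriv v θ) ∞ volume := v.memLp_deriv.mul' u.memLp_deriv
  exact ((h.locallyIntegrable le_top).integrableOn_isCompact isCompact_uIcc).intervalIntegrable

theorem W1.intervalIntegrable_mul_sub (u v : W1) (a b : ℝ) :
    IntervalIntegrable (fun θ => u θ * v θ - deriv u θ * deriv v θ) volume a b :=
  ((u.continuous.mul v.continuous).intervalIntegrable _ _).sub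
    (u.intervalIntegrable_deriv_mul v a b)

theorem memW1_max {f g : ℝ → ℝ} (hf : MemW1 f) (hg : MemW1 g) :
    MemW1 fun θ => max (f θ) (g θ) := by
  obtain ⟨pf, C, hC⟩ := memW1_iff.1 hf
  obtain ⟨pg, D, hD⟩ := memW1_iff.1 hg
  exact memW1_iff.2 ⟨fun θ => by simp only [pf θ, pg θ], _, hC.max hD⟩

theorem memW1_min {f g : ℝ → ℝ} (hf : MemW1 f) (hg : MemW1 g) :
    MemW1 fun θ => min (f θ) (g θ) := by
  obtain ⟨pf, C, hC⟩ := memW1_iff.1 hf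
  obtain ⟨pg, D, hD⟩ := memW1_iff.1 hg
  exact memW1_iff.2 ⟨fun θ => by simp only [pf θ, pg θ], _, hC.min hD⟩

theorem memW1_zero : MemW1 fun _ => 0 := W1Sub.zero_mem'

theorem memW1_trig (α β : ℝ) : MemW1 fun θ => α * Real.cos θ + β * Real.sin θ := by
  have hs : MemW1 Real.sin := memW1_iff.2 ⟨Real.sin_periodic, 1, Real.lipschitzWith_sin⟩
  have hc : MemW1 Real.cos := memW1_iff.2 ⟨Real.cos_periodic, 1, Real.lipschitzWith_cos⟩
  exact W1Sub.add_mem' (W1Sub.smul_mem' α hc) (W1Sub.smul_mem' β hs)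

theorem memW1_mul_sin_sub (A a : ℝ) : MemW1 fun θ => A * Real.sin (θ - a) := by
  convert memW1_trig (-(A * Real.sin a)) (A * Real.cos a) using 2 with θ
  rw [Real.sin_sub]; ring

theorem memW1_mul_sin_sub' (A a : ℝ) : MemW1 fun θ => A * Real.sin (a - θ) := by
  convert memW1_trig (A * Real.sin a) (-(A * Real.cos a)) using 2 with θ
  rw [Real.sin_sub]; ring

/-! ### Trigonometric convexity -/

theorem W1.integral_mul_sin_sub (u : W1) (c a b : ℝ) :
    ∫ θ in a..b, (u θ * Real.sin (θ - c) - deriv u θ * Real.cos (θ - c))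
      = u a * Real.cos (a - c) - u b * Real.cos (b - c) := by
  have hd : ∀ θ, HasDerivAt (fun θ => Real.cos (θ - c)) (-Real.sin (θ - c)) θ := fun θ => by
    simpa using (Real.hasDerivAt_cos (θ - c)).comp_sub_const θ c
  have hL : LipschitzWith 1 (fun θ => Real.cos (θ - c)) := by
    have h := Real.lipschitzWith_cos.comp (LipschitzWith.id.sub (LipschitzWith.const c))
    rw [add_zero, mul_one] at h
    exact h
  have h := (u.absolutelyContinuous a b).integral_deriv_mul_eq_sub
    (hL.lipschitzOnWith (s := uIcc a b)).absolutelyContinuousOnInterval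
  rw [← neg_inj, ← intervalIntegral.integral_neg, neg_sub, ← h]
  congr 1
  ext θ
  rw [(hd θ).deriv]
  ring

/-- The test function of the three-point inequality. For `b - a < π` it is, up to a constant factor,
the Green function of `v'' + v` on `[a, b]` with pole at `m`, extended by zero. Taking the positive
part of the minimum of two sine arches avoids a piecewise definition: this minimum is nonpositive
outside `[a, b] + 2πℤ` as long as `b - a ≤ π`. -/
noncomputable def tent (a m b : ℝ) : W1 :=
  W1.of (fun θ => max 0 (min (Real.sin (b - m) * Real.sin (θ - a))
    (Real.sin (m - a) * Real.sin (b - θ))))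
    (memW1_max memW1_zero (memW1_min (memW1_mul_sin_sub _ _) (memW1_mul_sin_sub' _ _)))

theorem tent_nonneg (a m b θ : ℝ) : 0 ≤ tent a m b θ := le_max_left _ _

section tent

variable {a m b : ℝ}

theorem sine_arches_sub (a m b θ : ℝ) :
    Real.sin (m - a) * Real.sin (b - θ) - Real.sin (b - m) * Real.sin (θ - a)
      = Real.sin (b - a) * Real.sin (m - θ) := by
  simp only [Real.sin_sub]
  ring_nf

theorem tent_eq_left (h1 : a ≤ m) (h2 : m ≤ b) (h3 : b ≤ a + Real.pi) {θ : ℝ}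
    (hθ : θ ∈ Icc a m) : tent a m b θ = Real.sin (b - m) * Real.sin (θ - a) := by
  have e := sine_arches_sub a m b θ
  have s1 : 0 ≤ Real.sin (b - a) := Real.sin_nonneg_of_nonneg_of_le_pi (by linarith) (by linarith)
  have s2 : 0 ≤ Real.sin (m - θ) :=
    Real.sin_nonneg_of_nonneg_of_le_pi (by linarith [hθ.2]) (by linarith [hθ.1])
  have s3 : 0 ≤ Real.sin (b - m) := Real.sin_nonneg_of_nonneg_of_le_pi (by linarith) (by linarith)
  have s4 : 0 ≤ Real.sin (θ - a) :=
    Real.sin_nonneg_of_nonneg_of_le_pi (by linarith [hθ.1]) (by linarith [hθ.2])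
  have := mul_nonneg s1 s2
  have := mul_nonneg s3 s4
  simp only [tent, W1.of_apply]
  rw [min_eq_left (by linarith), max_eq_right (by linarith)]

theorem tent_eq_right (h1 : a ≤ m) (h2 : m ≤ b) (h3 : b ≤ a + Real.pi) {θ : ℝ}
    (hθ : θ ∈ Icc m b) : tent a m b θ = Real.sin (m - a) * Real.sin (b - θ) := by
  have e := sine_arches_sub a m b θ
  have s1 : 0 ≤ Real.sin (b - a) := Real.sin_nonneg_of_nonneg_of_le_pi (by linarith) (by linarith)
  have s2 : 0 ≤ Real.sin (θ - m) :=
    Real.sin_nonneg_of_nonneg_of_le_pi (by linarith [hθ.1]) (by linarith [hθ.2])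
  rw [← neg_sub θ m, Real.sin_neg] at e
  have s3 : 0 ≤ Real.sin (m - a) := Real.sin_nonneg_of_nonneg_of_le_pi (by linarith) (by linarith)
  have s4 : 0 ≤ Real.sin (b - θ) :=
    Real.sin_nonneg_of_nonneg_of_le_pi (by linarith [hθ.2]) (by linarith [hθ.1])
  have := mul_nonneg s1 s2
  have := mul_nonneg s3 s4
  simp only [tent, W1.of_apply]
  rw [min_eq_right (by linarith), max_eq_right (by linarith)]

theorem tent_eq_zero (h1 : a ≤ m) (h2 : m ≤ b) (h3 : b ≤ a + Real.pi) {θ : ℝ}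
    (hθ : θ ∈ Icc b (a + 2 * Real.pi)) : tent a m b θ = 0 := by
  have s3 : 0 ≤ Real.sin (m - a) := Real.sin_nonneg_of_nonneg_of_le_pi (by linarith) (by linarith)
  have s4 : 0 ≤ Real.sin (b - m) := Real.sin_nonneg_of_nonneg_of_le_pi (by linarith) (by linarith)
  simp only [tent, W1.of_apply]
  apply max_eq_left
  rcases le_total θ (a + Real.pi) with h | h
  · apply (min_le_right _ _).trans
    apply mul_nonpos_of_nonneg_of_nonpos s3
    exact Real.sin_nonpos_of_nonpos_of_neg_pi_le (by linarith [hθ.1]) (by linarith [hθ.1])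
  · apply (min_le_left _ _).trans
    apply mul_nonpos_of_nonneg_of_nonpos s4
    rw [← Real.sin_sub_two_pi]
    exact Real.sin_nonpos_of_nonpos_of_neg_pi_le (by linarith [hθ.2]) (by linarith [hθ.1])

theorem deriv_eq_of_eqOn_Ioo {f g : ℝ → ℝ} {a b θ : ℝ} (h : EqOn f g (Ioo a b))
    (hθ : θ ∈ Ioo a b) : deriv f θ = deriv g θ :=
  (h.eventuallyEq_of_mem (isOpen_Ioo.mem_nhds hθ)).deriv_eq

/-- A function with `u'' + u ≥ 0` lies below its trigonometric chords: if `w'' + w = 0` and `w = u`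
at `a` and `b`, where `b - a ≤ π`, then `u ≤ w` on `[a, b]`. -/
theorem IsConvexGauge.three_point {u : W1} (hu : IsConvexGauge u) (h1 : a ≤ m) (h2 : m ≤ b)
    (h3 : b ≤ a + Real.pi) :
    u m * Real.sin (b - a) ≤ u a * Real.sin (b - m) + u b * Real.sin (m - a) := by
  have hpi := Real.pi_pos
  have key := hu (tent a m b) (tent_nonneg a m b)
  set v := tent a m b with hv
  have hper : Function.Periodic (fun θ => u θ * v θ - deriv u θ * deriv v θ) (2 * Real.pi) := by
    intro θ
    simp only [u.periodic θ, v.periodic θ, periodic_deriv u.periodic θ, periodic_deriv v.periodic θ]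
  have e := hper.intervalIntegral_add_eq 0 a
  rw [zero_add] at e
  rw [e, ← intervalIntegral.integral_add_adjacent_intervals
      (u.intervalIntegrable_mul_sub v a b) (u.intervalIntegrable_mul_sub v b _),
    ← intervalIntegral.integral_add_adjacent_intervals
      (u.intervalIntegrable_mul_sub v a m) (u.intervalIntegrable_mul_sub v m b)] at key
  have i1 : ∫ θ in a..m, (u θ * v θ - deriv u θ * deriv v θ)
      = Real.sin (b - m) * (u a * Real.cos (a - a) - u m * Real.cos (m - a)) := by
    rw [← u.integral_mul_sin_sub, ← intervalIntegral.integral_const_mul]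
    refine intervalIntegral.integral_congr_Ioo_of_le h1 fun θ hθ => ?_
    have hd : deriv v θ = Real.sin (b - m) * Real.cos (θ - a) := by
      rw [deriv_eq_of_eqOn_Ioo (g := fun θ => Real.sin (b - m) * Real.sin (θ - a))
        (fun x hx => tent_eq_left h1 h2 h3 (Ioo_subset_Icc_self hx)) hθ]
      exact (((Real.hasDerivAt_sin (θ - a)).comp_sub_const θ a).const_mul _).deriv
    rw [hd, hv, tent_eq_left h1 h2 h3 (Ioo_subset_Icc_self hθ)]
    ring
  have i2 : ∫ θ in m..b, (u θ * v θ - deriv u θ * deriv v θ)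
      = - Real.sin (m - a) * (u m * Real.cos (m - b) - u b * Real.cos (b - b)) := by
    rw [← u.integral_mul_sin_sub, ← intervalIntegral.integral_const_mul]
    refine intervalIntegral.integral_congr_Ioo_of_le h2 fun θ hθ => ?_
    have hd : deriv v θ = - Real.sin (m - a) * Real.cos (θ - b) := by
      rw [deriv_eq_of_eqOn_Ioo (g := fun θ => - Real.sin (m - a) * Real.sin (θ - b))
        (fun x hx => ?_) hθ]
      · exact (((Real.hasDerivAt_sin (θ - b)).comp_sub_const θ b).const_mul _).deriv
      · rw [tent_eq_right h1 h2 h3 (Ioo_subset_Icc_self hx), ← neg_sub x b, Real.sin_neg]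
        ring
    rw [hd, hv, tent_eq_right h1 h2 h3 (Ioo_subset_Icc_self hθ), ← neg_sub θ b, Real.sin_neg]
    ring
  have i3 : ∫ θ in b..(a + 2 * Real.pi), (u θ * v θ - deriv u θ * deriv v θ) = 0 := by
    rw [← intervalIntegral.integral_zero (μ := volume) (a := b) (b := a + 2 * Real.pi)]
    refine intervalIntegral.integral_congr_Ioo_of_le (by linarith) fun θ hθ => ?_
    have hd : deriv v θ = 0 := by
      rw [deriv_eq_of_eqOn_Ioo (g := fun θ => 0)
        (fun x hx => tent_eq_zero h1 h2 h3 (Ioo_subset_Icc_self hx)) hθ]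
      simp
    rw [hd, hv, tent_eq_zero h1 h2 h3 (Ioo_subset_Icc_self hθ)]
    ring
  rw [i1, i2, i3, sub_self, sub_self, Real.cos_zero, ← neg_sub b m, Real.cos_neg] at key
  have e2 : Real.sin (b - a) = Real.sin (b - m) * Real.cos (m - a)
      + Real.cos (b - m) * Real.sin (m - a) := by
    rw [← Real.sin_add]; ring_nf
  rw [e2]
  linarith

end tent

/-- The midpoint case of trigonometric convexity. -/
theorem IsConvexGauge.midpoint {u : W1} (hu : IsConvexGauge u) (x : ℝ) {h : ℝ} (h0 : 0 < h)
    (h1 : h < Real.pi / 2) : 2 * Real.cos h * u x ≤ u (x + h) + u (x - h) := by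
  have := hu.three_point (a := x - h) (m := x) (b := x + h) (by linarith) (by linarith)
    (by linarith)
  rw [show x + h - (x - h) = 2 * h by ring, show x + h - x = h by ring,
    show x - (x - h) = h by ring, Real.sin_two_mul] at this
  have hs : 0 < Real.sin h := Real.sin_pos_of_pos_of_lt_pi h0 (by linarith [Real.pi_pos])
  nlinarith


/-- The midpoint inequality at small scales gives back `u'' + u ≥ 0`: a discrete integration by
parts turns it into a bound on `∫ (Δ_h u / h) (Δ_h v / h)`, in which `h → 0`. -/
theorem isConvexGauge_of_midpoint {u : W1} (h0 : ∀ θ, 0 ≤ u θ) {δ : ℝ} (hδ : 0 < δ)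
    (hm : ∀ x h : ℝ, 0 < h → h < δ → 2 * Real.cos h * u x ≤ u (x + h) + u (x - h)) :
    IsConvexGauge u := by
  intro v hv
  have hpi := Real.pi_pos
  obtain ⟨A, hA⟩ := u.exists_lipschitz
  obtain ⟨B, hB⟩ := v.exists_lipschitz
  have huv : IntervalIntegrable (fun θ => u θ * v θ) volume 0 (2 * Real.pi) :=
    (u.continuous.mul v.continuous).intervalIntegrable _ _
  have huv0 : 0 ≤ ∫ θ in (0 : ℝ)..(2 * Real.pi), u θ * v θ :=
    intervalIntegral.integral_nonneg (by positivity) fun θ _ => mul_nonneg (h0 θ) (hv θ)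
  rw [intervalIntegral.integral_sub huv (u.intervalIntegrable_deriv_mul v _ _), sub_nonneg]
  let s : ℕ → ℝ := fun n => 1 / ((n : ℝ) + 1)
  have hs0 : ∀ n, 0 < s n := fun n => by positivity
  have hs : Tendsto s atTop (𝓝 0) := tendsto_one_div_add_atTop_nhds_zero_nat
  have hs' : Tendsto s atTop (𝓝[≠] 0) :=
    tendsto_nhdsWithin_iff.2 ⟨hs, Eventually.of_forall fun n => (hs0 n).ne'⟩
  have hlim : Tendsto (fun n => ∫ θ in (0 : ℝ)..(2 * Real.pi),
      ((s n)⁻¹ * (u (θ + s n) - u θ)) * ((s n)⁻¹ * (v (θ + s n) - v θ))) atTop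
      (𝓝 (∫ θ in (0 : ℝ)..(2 * Real.pi), deriv u θ * deriv v θ)) := by
    refine intervalIntegral.tendsto_integral_filter_of_dominated_convergence
      (fun _ => (A : ℝ) * B) (Eventually.of_forall fun n => ?_)
      (Eventually.of_forall fun n => Eventually.of_forall fun θ _ => ?_)
      (continuous_const.intervalIntegrable _ _) ?_
    · have hu := u.continuous
      have hv := v.continuous
      exact Continuous.aestronglyMeasurable (by fun_prop)
    · have e : ∀ {f : ℝ → ℝ} {C : ℝ≥0}, LipschitzWith C f →
          ‖(s n)⁻¹ * (f (θ + s n) - f θ)‖ ≤ C := by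
        intro f C hf
        have := hf.dist_le_mul (θ + s n) θ
        rw [Real.dist_eq, Real.dist_eq, add_sub_cancel_left, abs_of_pos (hs0 n)] at this
        rw [norm_mul, norm_inv, Real.norm_of_nonneg (hs0 n).le, Real.norm_eq_abs,
          inv_mul_le_iff₀ (hs0 n)]
        linarith
      rw [norm_mul]
      exact mul_le_mul (e hA) (e hB) (norm_nonneg _) A.2
    · filter_upwards [u.ae_differentiableAt, v.ae_differentiableAt] with θ hu hv _
      exact (hu.hasDerivAt.tendsto_slope_zero.comp hs').mul
        (hv.hasDerivAt.tendsto_slope_zero.comp hs')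
  refine le_of_tendsto hlim ?_
  filter_upwards [hs.eventually_lt_const hδ] with n hn
  set h := s n with hh
  have hpos : 0 < h := hs0 n
  have cu := u.continuous
  have cv := v.continuous
  have hsq : ∫ θ in (0 : ℝ)..(2 * Real.pi), (h⁻¹ * (u (θ + h) - u θ)) * (h⁻¹ * (v (θ + h) - v θ))
      = h⁻¹ ^ 2 * ∫ θ in (0 : ℝ)..(2 * Real.pi), (u (θ + h) - u θ) * (v (θ + h) - v θ) := by
    rw [← intervalIntegral.integral_const_mul]
    congr 1
    ext θ
    ring
  have hshift : ∫ θ in (0 : ℝ)..(2 * Real.pi), (u (θ + h) - u θ) * v (θ + h)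
      = ∫ θ in (0 : ℝ)..(2 * Real.pi), (u θ - u (θ - h)) * v θ := by
    have hper : Function.Periodic (fun θ => (u θ - u (θ - h)) * v θ) (2 * Real.pi) := by
      intro θ
      have : θ + 2 * Real.pi - h = (θ - h) + 2 * Real.pi := by ring
      simp only [this, u.periodic _, v.periodic _]
    have e := hper.intervalIntegral_add_eq 0 h
    rw [zero_add] at e
    have e' := intervalIntegral.integral_comp_add_right (a := 0) (b := 2 * Real.pi)
      (fun θ => (u θ - u (θ - h)) * v θ) h
    simp only [add_sub_cancel_right, zero_add] at e'
    rw [e, e', add_comm h]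
  have hparts : ∫ θ in (0 : ℝ)..(2 * Real.pi), (u (θ + h) - u θ) * (v (θ + h) - v θ)
      = ∫ θ in (0 : ℝ)..(2 * Real.pi), (2 * u θ - u (θ + h) - u (θ - h)) * v θ := by
    have e : ∀ θ, (u (θ + h) - u θ) * (v (θ + h) - v θ)
        = (u (θ + h) - u θ) * v (θ + h) - (u (θ + h) - u θ) * v θ := fun θ => by ring
    simp_rw [e]
    rw [intervalIntegral.integral_sub, hshift, ← intervalIntegral.integral_sub]
    · congr 1; ext θ; ring
    all_goals exact Continuous.intervalIntegrable (by fun_prop) _ _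
  rw [hsq, hparts, inv_pow, inv_mul_le_iff₀ (by positivity),
    ← intervalIntegral.integral_const_mul]
  apply intervalIntegral.integral_mono_on (by positivity)
  · exact Continuous.intervalIntegrable (by fun_prop) _ _
  · exact Continuous.intervalIntegrable (by fun_prop) _ _
  · intro θ _
    rw [← mul_assoc]
    refine mul_le_mul_of_nonneg_right ?_ (hv θ)
    have h1 := hm θ h hpos hn
    have h2 := mul_le_mul_of_nonneg_right (Real.one_sub_sq_div_two_le_cos (x := h)) (h0 θ)
    linarith

/-! ### The derivative is monotone up to a linear function -/

/-- A continuous function that is midpoint convex at small scales is convex: otherwise its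
difference with some chord has a positive maximum, and the leftmost maximum point violates the
midpoint inequality. -/
theorem convexOn_of_midpoint {f : ℝ → ℝ} (hc : Continuous f) {δ : ℝ} (hδ : 0 < δ)
    (hm : ∀ x h : ℝ, 0 < h → h < δ → 2 * f x ≤ f (x + h) + f (x - h)) :
    ConvexOn ℝ univ f := by
  refine convexOn_of_slope_mono_adjacent convex_univ fun {x y z} _ _ hxy hyz => ?_
  have hxz : x < z := hxy.trans hyz
  set σ := (f z - f x) / (z - x) with hσ
  have hσ' : σ * (z - x) = f z - f x := div_mul_cancel₀ _ (sub_pos.2 hxz).ne'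
  set ψ : ℝ → ℝ := fun t => f t - (f x + σ * (t - x)) with hψ
  have hψc : Continuous ψ := by fun_prop
  have key : ψ y ≤ 0 := by
    by_contra! hy
    obtain ⟨t₁, ht₁, hmax⟩ := isCompact_Icc.exists_isMaxOn (nonempty_Icc.2 hxz.le) hψc.continuousOn
    have hmax' : ∀ s ∈ Icc x z, ψ s ≤ ψ t₁ := fun s hs => hmax hs
    obtain ⟨t, ⟨htI, htm⟩, hleast⟩ :=
      (isCompact_Icc.inter_right (isClosed_singleton.preimage hψc) :
        IsCompact (Icc x z ∩ ψ ⁻¹' {ψ t₁})).exists_isLeast ⟨t₁, ht₁, rfl⟩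
    have htm : ψ t = ψ t₁ := htm
    have hpos : 0 < ψ t := htm ▸ hy.trans_le (hmax' y ⟨hxy.le, hyz.le⟩)
    have hx0 : ψ x = 0 := by simp [hψ]
    have hz0 : ψ z = 0 := by simp only [hψ]; linarith
    have htx : x < t := lt_of_le_of_ne htI.1 (by rintro rfl; linarith)
    have htz : t < z := lt_of_le_of_ne htI.2 (by rintro rfl; linarith)
    obtain ⟨h, hh0, hh⟩ := exists_between (lt_min hδ (lt_min (sub_pos.2 htx) (sub_pos.2 htz)))
    rw [lt_min_iff, lt_min_iff] at hh
    have a1 := hm t h hh0 hh.1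
    have a2 : ψ (t + h) ≤ ψ t := htm ▸ hmax' _ ⟨by linarith, by linarith⟩
    have hI : t - h ∈ Icc x z := ⟨by linarith, by linarith⟩
    have a3 : ψ (t - h) < ψ t := by
      refine lt_of_le_of_ne (htm ▸ hmax' _ hI) fun he => ?_
      have := hleast ⟨hI, show ψ (t - h) = ψ t₁ from he.trans htm⟩
      linarith
    simp only [hψ] at a2 a3
    linarith
  simp only [hψ] at key
  rw [div_le_div_iff₀ (by linarith) (by linarith)]
  have h1 : f y - f x ≤ σ * (y - x) := by linarith
  have h2 : σ * (z - y) ≤ f z - f y := by nlinarith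
  nlinarith [mul_le_mul_of_nonneg_right h1 (sub_nonneg.2 hyz.le),
    mul_le_mul_of_nonneg_right h2 (sub_nonneg.2 hxy.le)]

theorem IsConvexGauge.exists_monotone {u : W1} (hu : IsConvexGauge u) (h0 : ∀ θ, 0 ≤ u θ) {M : ℝ}
    (hM : ∀ θ, u θ ≤ M) :
    ∃ F : ℝ → ℝ, Monotone F ∧ ∀ᵐ θ, deriv u θ = F θ - M * θ := by
  have cu := u.continuous
  set U : ℝ → ℝ := fun θ => u θ + M / 2 * θ ^ 2 with hU
  have hconv : ConvexOn ℝ univ U := by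
    refine convexOn_of_midpoint (by fun_prop) (δ := Real.pi / 2) (by positivity) ?_
    intro x h hh0 hh
    have h1 := hu.midpoint x hh0 hh
    have h2 := mul_le_mul_of_nonneg_right (Real.one_sub_sq_div_two_le_cos (x := h)) (h0 x)
    have h3 := mul_le_mul_of_nonneg_left (hM x) (sq_nonneg h)
    simp only [hU]
    nlinarith
  refine ⟨fun x => derivWithin U (Ioi x) x, ?_, ?_⟩
  · have := hconv.monotoneOn_rightDeriv
    rw [interior_univ] at this
    exact monotoneOn_univ.1 this
  · filter_upwards [u.ae_differentiableAt] with θ hθ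
    have h1 : HasDerivAt U (deriv u θ + M / 2 * (2 * θ)) θ := by
      refine hθ.hasDerivAt.add (HasDerivAt.const_mul _ ?_)
      simpa using hasDerivAt_pow 2 θ
    rw [h1.hasDerivWithinAt.derivWithin (uniqueDiffWithinAt_Ioi θ)]
    ring


/-! ### Cutting off a cap -/

/-- The solution `w` of `w'' + w = 0` with `w = u` at `a` and at `b`. In polar coordinates, with `u`
the gauge function of a convex body, this is the line through the boundary points at the angles
`a` and `b`. It is meaningful when `sin (b - a) ≠ 0`. -/
noncomputable def chord (u : W1) (a b : ℝ) : W1 :=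
  W1.of (fun θ => u a / Real.sin (b - a) * Real.sin (b - θ)
    + u b / Real.sin (b - a) * Real.sin (θ - a))
    (W1Sub.add_mem' (memW1_mul_sin_sub' _ _) (memW1_mul_sin_sub _ _))

theorem chord_apply (u : W1) (a b θ : ℝ) :
    chord u a b θ = u a / Real.sin (b - a) * Real.sin (b - θ)
      + u b / Real.sin (b - a) * Real.sin (θ - a) := rfl

/-- The perturbation `max (w - u) 0`, with `w` the chord of `u` over `[a, b]`. Adding it to `u` cuts
the convex body along the chord. -/
noncomputable def cap (u : W1) (a b : ℝ) : W1 :=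
  W1.of (fun θ => max (chord u a b θ - u θ) 0)
    (memW1_max (W1Sub.sub_mem (chord u a b).memW1 u.memW1) memW1_zero)

theorem cap_apply (u : W1) (a b θ : ℝ) : cap u a b θ = max (chord u a b θ - u θ) 0 := rfl

theorem cap_nonneg (u : W1) (a b θ : ℝ) : 0 ≤ cap u a b θ := le_max_right _ _

section

variable {u : W1} {a b : ℝ}

theorem chord_left (h : 0 < Real.sin (b - a)) : chord u a b a = u a := by
  rw [chord_apply, sub_self, Real.sin_zero, mul_zero, add_zero, div_mul_cancel₀ _ h.ne']

theorem chord_right (h : 0 < Real.sin (b - a)) : chord u a b b = u b := by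
  rw [chord_apply, sub_self, Real.sin_zero, mul_zero, zero_add, div_mul_cancel₀ _ h.ne']

theorem chord_mul_sin (h : 0 < Real.sin (b - a)) (θ : ℝ) :
    chord u a b θ * Real.sin (b - a) = u a * Real.sin (b - θ) + u b * Real.sin (θ - a) := by
  rw [chord_apply]
  field_simp

theorem chord_midpoint (x h : ℝ) :
    chord u a b (x + h) + chord u a b (x - h) = 2 * Real.cos h * chord u a b x := by
  have e1 : b - (x + h) = (b - x) - h := by ring
  have e2 : b - (x - h) = (b - x) + h := by ring
  have e3 : x + h - a = (x - a) + h := by ring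
  have e4 : x - h - a = (x - a) - h := by ring
  simp only [chord_apply, e1, e2, e3, e4, Real.sin_add, Real.sin_sub (b - x) h,
    Real.sin_sub (x - a) h]
  ring

theorem le_chord (hu : IsConvexGauge u) (hab : a < b) (hb : b < a + Real.pi) {θ : ℝ}
    (hθ : θ ∈ Icc a b) : u θ ≤ chord u a b θ := by
  have hs : 0 < Real.sin (b - a) := Real.sin_pos_of_pos_of_lt_pi (by linarith) (by linarith)
  rw [← mul_le_mul_iff_left₀ hs, chord_mul_sin hs]
  exact hu.three_point hθ.1 hθ.2 hb.le

/-- The line through two boundary points of a convex body does not enter the body outside the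
angular sector spanned by them. -/
theorem chord_le (hu : IsConvexGauge u) (hab : a < b) (hb : b < a + Real.pi) {θ : ℝ}
    (hθ : θ ∈ Icc b (a + 2 * Real.pi)) : chord u a b θ ≤ u θ := by
  have hs : 0 < Real.sin (b - a) := Real.sin_pos_of_pos_of_lt_pi (by linarith) (by linarith)
  rcases le_total θ (a + Real.pi) with h | h
  · rw [← mul_le_mul_iff_left₀ hs, chord_mul_sin hs]
    have := hu.three_point hab.le hθ.1 h
    rw [← neg_sub θ b, Real.sin_neg]
    linarith
  rcases le_total θ (b + Real.pi) with h' | h'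
  · -- At antipodal points `u(θ - π) + u(θ) ≥ 0`, while the chord is odd under `θ ↦ θ - π`.
    have h1 := hu.three_point (a := θ - Real.pi) (m := θ - Real.pi / 2) (b := θ)
      (by linarith [Real.pi_pos]) (by linarith [Real.pi_pos]) (by linarith)
    rw [show θ - (θ - Real.pi) = Real.pi by ring,
      show θ - (θ - Real.pi / 2) = Real.pi / 2 by ring,
      show θ - Real.pi / 2 - (θ - Real.pi) = Real.pi / 2 by ring, Real.sin_pi,
      Real.sin_pi_div_two] at h1
    have h2 := le_chord hu hab hb (θ := θ - Real.pi) ⟨by linarith, by linarith⟩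
    have h3 : chord u a b (θ - Real.pi) = - chord u a b θ := by
      rw [chord_apply, chord_apply, show b - (θ - Real.pi) = (b - θ) + Real.pi by ring,
        show θ - Real.pi - a = (θ - a) - Real.pi by ring, Real.sin_add_pi, Real.sin_sub_pi]
      ring
    linarith
  · have h1 := hu.three_point (a := θ - 2 * Real.pi) (m := a) (b := b) (by linarith [hθ.2]) hab.le
      (by linarith)
    rw [u.periodic.sub_eq] at h1
    rw [show b - (θ - 2 * Real.pi) = b - θ + 2 * Real.pi by ring, Real.sin_add_two_pi,
      show a - (θ - 2 * Real.pi) = -(θ - a) + 2 * Real.pi by ring, Real.sin_add_two_pi,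
      Real.sin_neg] at h1
    rw [← mul_le_mul_iff_left₀ hs, chord_mul_sin hs]
    linarith

theorem cap_eq_sub (hu : IsConvexGauge u) (hab : a < b) (hb : b < a + Real.pi) {θ : ℝ}
    (hθ : θ ∈ Icc a b) : cap u a b θ = chord u a b θ - u θ :=
  max_eq_left (sub_nonneg.2 (le_chord hu hab hb hθ))

theorem cap_eq_zero (hu : IsConvexGauge u) (hab : a < b) (hb : b < a + Real.pi) {θ : ℝ}
    (hθ : θ ∈ Icc b (a + 2 * Real.pi)) : cap u a b θ = 0 :=
  max_eq_right (sub_nonpos.2 (chord_le hu hab hb hθ))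

theorem isConvexGauge_add_smul_cap (hu : IsConvexGauge u) (h0 : ∀ θ, 0 ≤ u θ) {t : ℝ} (ht0 : 0 ≤ t)
    (ht1 : t ≤ 1) : IsConvexGauge (u + t • cap u a b) := by
  refine isConvexGauge_of_midpoint (δ := Real.pi / 2)
    (fun θ => add_nonneg (h0 θ) (mul_nonneg ht0 (cap_nonneg u a b θ))) (by positivity) ?_
  intro x h hh0 hh
  have hcos : 0 < Real.cos h := Real.cos_pos_of_mem_Ioo ⟨by linarith, hh⟩
  have hmid := hu.midpoint x hh0 hh
  have hmax : ∀ θ, cap u a b θ = max (chord u a b θ) (u θ) - u θ := by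
    intro θ
    rw [cap_apply, max_sub_sub_right (chord u a b θ) (u θ) (u θ) |>.symm, sub_self]
  have hmid' : 2 * Real.cos h * max (chord u a b x) (u x)
      ≤ max (chord u a b (x + h)) (u (x + h)) + max (chord u a b (x - h)) (u (x - h)) := by
    rw [mul_max_of_nonneg _ _ (by positivity), ← chord_midpoint]
    exact max_le (add_le_add (le_max_left _ _) (le_max_left _ _))
      (hmid.trans (add_le_add (le_max_right _ _) (le_max_right _ _)))
  simp only [W1.coe_add, W1.coe_smul, hmax]
  have e1 := mul_le_mul_of_nonneg_left hmid' ht0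
  have e2 := mul_le_mul_of_nonneg_left hmid (sub_nonneg.2 ht1)
  linarith

theorem hasDerivAt_chord (u : W1) (a b θ : ℝ) :
    HasDerivAt (chord u a b) (u a / Real.sin (b - a) * -Real.cos (b - θ)
      + u b / Real.sin (b - a) * Real.cos (θ - a)) θ :=
  (((Real.hasDerivAt_sin (b - θ)).comp_const_sub b θ).const_mul _).add
    (((Real.hasDerivAt_sin (θ - a)).comp_sub_const θ a).const_mul _)

theorem hasDerivAt_deriv_chord (u : W1) (a b θ : ℝ) :
    HasDerivAt (deriv (chord u a b)) (-chord u a b θ) θ := by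
  have h : deriv (chord u a b) = fun θ => u a / Real.sin (b - a) * -Real.cos (b - θ)
      + u b / Real.sin (b - a) * Real.cos (θ - a) :=
    funext fun θ => (hasDerivAt_chord u a b θ).deriv
  rw [h]
  have h1 := (((Real.hasDerivAt_cos (b - θ)).comp_const_sub b θ).neg.const_mul
    (u a / Real.sin (b - a))).add
    (((Real.hasDerivAt_cos (θ - a)).comp_sub_const θ a).const_mul (u b / Real.sin (b - a)))
  refine HasDerivAt.congr_deriv h1 ?_
  rw [chord_apply]
  ring

/-- Over a short interval the slope of the chord is nearly the difference quotient of `u`. -/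
theorem abs_deriv_chord_sub_le {M : ℝ} (h0 : ∀ θ, 0 ≤ u θ) (hM : ∀ θ, u θ ≤ M) (hab : a < b)
    (hb : b ≤ a + Real.pi / 2) {θ : ℝ} (hθ : θ ∈ Icc a b) :
    |deriv (chord u a b) θ - (u b - u a) / (b - a)| ≤ 2 * M * (b - a) := by
  have hpi := Real.pi_pos
  have hs : 0 < Real.sin (b - a) := Real.sin_pos_of_pos_of_lt_pi (by linarith) (by linarith)
  have hbd : ∀ x ∈ Icc a b, ‖-chord u a b x‖ ≤ 2 * M := by
    intro x hx
    have s1 : 0 ≤ Real.sin (b - x) :=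
      Real.sin_nonneg_of_nonneg_of_le_pi (by linarith [hx.2]) (by linarith [hx.1])
    have s2 : 0 ≤ Real.sin (x - a) :=
      Real.sin_nonneg_of_nonneg_of_le_pi (by linarith [hx.1]) (by linarith [hx.2])
    have s3 : Real.sin (b - x) ≤ Real.sin (b - a) :=
      Real.sin_le_sin_of_le_of_le_pi_div_two (by linarith [hx.2]) (by linarith) (by linarith [hx.1])
    have s4 : Real.sin (x - a) ≤ Real.sin (b - a) :=
      Real.sin_le_sin_of_le_of_le_pi_div_two (by linarith [hx.1]) (by linarith) (by linarith [hx.2])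
    have e := chord_mul_sin (u := u) hs x
    have e1 : u a * Real.sin (b - x) ≤ M * Real.sin (b - a) :=
      mul_le_mul (hM a) s3 s1 ((h0 a).trans (hM a))
    have e2 : u b * Real.sin (x - a) ≤ M * Real.sin (b - a) :=
      mul_le_mul (hM b) s4 s2 ((h0 b).trans (hM b))
    have e3 := mul_nonneg (h0 a) s1
    have e4 := mul_nonneg (h0 b) s2
    rw [norm_neg, Real.norm_of_nonneg]
    · rw [← mul_le_mul_iff_left₀ hs]; linarith
    · rw [← mul_le_mul_iff_left₀ hs]; linarith
  obtain ⟨ξ, hξ, hξ'⟩ := exists_deriv_eq_slope (chord u a b) hab (chord u a b).continuous.continuousOn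
    (fun x _ => (hasDerivAt_chord u a b x).differentiableAt.differentiableWithinAt)
  rw [chord_left hs, chord_right hs] at hξ'
  rw [← hξ']
  have h1 := (convex_Icc a b).norm_image_sub_le_of_norm_hasDerivWithin_le
    (fun x _ => (hasDerivAt_deriv_chord u a b x).hasDerivWithinAt) hbd (Ioo_subset_Icc_self hξ) hθ
  have hM0 : 0 ≤ M := (h0 a).trans (hM a)
  refine (Real.norm_eq_abs _ ▸ h1).trans (mul_le_mul_of_nonneg_left ?_ (by positivity))
  rw [Real.norm_eq_abs, abs_le]
  constructor <;> linarith [hξ.1, hξ.2, hθ.1, hθ.2]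

end


/-! ### The compact box of arguments of the integrand -/

theorem abs_le_of_hasDerivWithinAt {f : ℝ → ℝ} {C : ℝ≥0} (hf : LipschitzWith C f) {s : Set ℝ}
    {x q : ℝ} [NeBot (𝓝[s \ {x}] x)] (h : HasDerivWithinAt f q s x) : q ∈ Icc (-(C : ℝ)) C := by
  rw [hasDerivWithinAt_iff_tendsto_slope] at h
  refine isClosed_Icc.mem_of_tendsto h (Eventually.of_forall fun y => ?_)
  rw [mem_Icc, ← abs_le, slope_def_field, abs_div]
  refine div_le_of_le_mul₀ (abs_nonneg _) C.2 ?_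
  simpa [Real.dist_eq] using hf.dist_le_mul y x

theorem W1.deriv_mem_convDeriv (u : W1) : ∀ᵐ θ, deriv u θ ∈ convDeriv u := by
  filter_upwards [u.ae_differentiableAt] with θ hθ
  exact subset_closure (subset_convexHull _ _ ⟨θ, Or.inl hθ.hasDerivAt.hasDerivWithinAt⟩)

theorem W1.exists_range_eq (u : W1) : ∃ m M : ℝ, m ≤ M ∧ range u = Icc m M := by
  have hc : IsCompact (range u) :=
    u.periodic.compact_of_continuous (by positivity) u.continuous
  have h := eq_Icc_of_connected_compact (isConnected_range u.continuous) hc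
  exact ⟨_, _, nonempty_Icc.1 (h ▸ range_nonempty u), h⟩

theorem W1.exists_convDeriv_eq (u : W1) : ∃ q₁ q₂ : ℝ, q₁ ≤ q₂ ∧ convDeriv u = Icc q₁ q₂ := by
  obtain ⟨C, hC⟩ := u.exists_lipschitz
  have hconv : Convex ℝ (convDeriv u) := (convex_convexHull ℝ _).closure
  have hsub : convDeriv u ⊆ Icc (-(C : ℝ)) C := by
    refine closure_minimal (convexHull_min ?_ (convex_Icc _ _)) isClosed_Icc
    rintro q ⟨θ, h | h⟩
    · have : NeBot (𝓝[Ioi θ \ {θ}] θ) := by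
        rw [sdiff_singleton_eq_self (by simp)]; infer_instance
      exact abs_le_of_hasDerivWithinAt hC h
    · have : NeBot (𝓝[Iio θ \ {θ}] θ) := by
        rw [sdiff_singleton_eq_self (by simp)]; infer_instance
      exact abs_le_of_hasDerivWithinAt hC h
  have hc : IsCompact (convDeriv u) := isCompact_Icc.of_isClosed_subset isClosed_closure hsub
  have hne : (convDeriv u).Nonempty := u.deriv_mem_convDeriv.exists.elim fun θ h => ⟨_, h⟩
  have h := eq_Icc_of_connected_compact ⟨hne, hconv.isPreconnected⟩ hc
  exact ⟨_, _, nonempty_Icc.1 (h ▸ hne), h⟩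

/-- The box with sides `[α, β]`, `[m - δ, M + δ]` and `[q₁ - δ, q₂ + δ]`. -/
def box (α β m M q₁ q₂ δ : ℝ) : Set (ℝ × ℝ × ℝ) :=
  Icc α β ×ˢ (Icc (m - δ) (M + δ) ×ˢ Icc (q₁ - δ) (q₂ + δ))

theorem isCompact_box (α β m M q₁ q₂ δ : ℝ) : IsCompact (box α β m M q₁ q₂ δ) :=
  isCompact_Icc.prod (isCompact_Icc.prod isCompact_Icc)

theorem convex_box (α β m M q₁ q₂ δ : ℝ) : Convex ℝ (box α β m M q₁ q₂ δ) :=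
  (convex_Icc _ _).prod ((convex_Icc _ _).prod (convex_Icc _ _))

theorem exists_dist_le_of_mem_Icc {m M δ x : ℝ} (hm : m ≤ M) (hδ : 0 ≤ δ)
    (hx : x ∈ Icc (m - δ) (M + δ)) : ∃ y ∈ Icc m M, dist x y ≤ δ := by
  refine ⟨max m (min x M), ⟨le_max_left _ _, max_le hm (min_le_right _ _)⟩, ?_⟩
  rw [Real.dist_eq, abs_le]
  obtain ⟨h1, h2⟩ := hx
  grind

theorem exists_box_subset {U : Set (ℝ × ℝ × ℝ)} (hU : IsOpen U) {m M q₁ q₂ : ℝ} (hm : m ≤ M)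
    (hq : q₁ ≤ q₂) (h : univ ×ˢ (Icc m M ×ˢ Icc q₁ q₂) ⊆ U) (α β : ℝ) :
    ∃ δ > 0, box α β m M q₁ q₂ δ ⊆ U := by
  have hc : IsCompact (Icc α β ×ˢ (Icc m M ×ˢ Icc q₁ q₂)) :=
    isCompact_Icc.prod (isCompact_Icc.prod isCompact_Icc)
  obtain ⟨δ, hδ, hsub⟩ := hc.exists_cthickening_subset_open hU
    ((prod_mono_left (subset_univ _)).trans h)
  refine ⟨δ, hδ, fun z hz => hsub ?_⟩
  obtain ⟨h1, h2, h3⟩ := hz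
  obtain ⟨x, hx, hx'⟩ := exists_dist_le_of_mem_Icc hm hδ.le h2
  obtain ⟨q, hq, hq'⟩ := exists_dist_le_of_mem_Icc hq hδ.le h3
  refine Metric.mem_cthickening_of_dist_le z (z.1, x, q) δ _ ⟨h1, hx, hq⟩ ?_
  rw [Prod.dist_eq, Prod.dist_eq, dist_self]
  exact max_le hδ.le (max_le hx' hq')

/-! ### The first variation -/

theorem W1.exists_bound (v : W1) : ∃ V : ℝ, 0 ≤ V ∧ ∀ θ, |v θ| ≤ V ∧ |deriv v θ| ≤ V := by
  obtain ⟨C, hC⟩ := v.exists_lipschitz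
  obtain ⟨m, M, -, h⟩ := v.exists_range_eq
  refine ⟨max C (max |m| |M|), le_max_of_le_left C.2, fun θ => ⟨?_, ?_⟩⟩
  · have : v θ ∈ Icc m M := h ▸ mem_range_self θ
    exact (abs_le_max_abs_abs this.1 this.2).trans (le_max_right _ _)
  · exact (Real.norm_eq_abs _ ▸ norm_deriv_le_of_lipschitz hC).trans (le_max_left _ _)

theorem aestronglyMeasurable_comp_of_continuousOn {G : ℝ × ℝ × ℝ → ℝ} {U : Set (ℝ × ℝ × ℝ)}
    (hU : MeasurableSet U) (hG : ContinuousOn G U) {P : ℝ → ℝ × ℝ × ℝ} (hP : Measurable P)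
    {μ : Measure ℝ} (h : ∀ᵐ θ ∂μ, P θ ∈ U) : AEStronglyMeasurable (fun θ => G (P θ)) μ := by
  classical
  have hm : Measurable (U.piecewise G 0) := hG.measurable_piecewise continuousOn_const hU
  refine (hm.comp hP).aestronglyMeasurable.congr ?_
  filter_upwards [h] with θ hθ
  exact piecewise_eq_of_mem _ _ _ hθ

/-- The derivative of `t ↦ ∫ G(θ, u + t v, u' + t v')` at `t = 0`. -/
theorem hasDerivAt_integral_integrand {G : ℝ × ℝ × ℝ → ℝ} {U : Set (ℝ × ℝ × ℝ)} (hU : IsOpen U)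
    (hG : ContDiffOn ℝ 1 G U) {u v : W1} {m M q₁ q₂ a b δ : ℝ} (hab : a ≤ b) (hδ : 0 < δ)
    (hbox : box a b m M q₁ q₂ δ ⊆ U) (hu : ∀ θ, u θ ∈ Icc m M)
    (hu' : ∀ᵐ θ, deriv u θ ∈ Icc q₁ q₂) :
    (∀ᶠ t : ℝ in 𝓝 0, IntervalIntegrable (integrand G (u + t • v)) volume a b) ∧
    IntervalIntegrable (fun θ => fderiv ℝ G (θ, u θ, deriv u θ) (0, v θ, deriv v θ)) volume a b ∧
    HasDerivAt (fun t : ℝ => ∫ θ in a..b, integrand G (u + t • v) θ)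
      (∫ θ in a..b, fderiv ℝ G (θ, u θ, deriv u θ) (0, v θ, deriv v θ)) 0 := by
  obtain ⟨V, hV0, hV⟩ := v.exists_bound
  set K := box a b m M q₁ q₂ δ with hK
  have hKc : IsCompact K := isCompact_box _ _ _ _ _ _ _
  obtain ⟨C, hC⟩ := (hG.mono hbox).exists_lipschitzOnWith one_ne_zero (convex_box _ _ _ _ _ _ _) hKc
  obtain ⟨B, hB⟩ := hKc.exists_bound_of_continuousOn (hG.continuousOn.mono hbox)
  let P : ℝ → ℝ → ℝ × ℝ × ℝ := fun t θ => (θ, u θ + t * v θ, deriv u θ + t * deriv v θ)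
  have hPm : ∀ t, Measurable (P t) := by
    intro t
    have h1 := u.continuous.measurable
    have h2 := v.continuous.measurable
    have h3 := measurable_deriv u
    have h4 := measurable_deriv v
    fun_prop
  have hint : ∀ t, integrand G (u + t • v) =ᵐ[volume] fun θ => G (P t θ) := by
    intro t
    filter_upwards [u.ae_differentiableAt, v.ae_differentiableAt] with θ h1 h2
    have h3 : deriv (u + t • v) θ = deriv u θ + t * deriv v θ := by
      rw [W1.coe_add, W1.coe_smul]
      exact (h1.hasDerivAt.add (h2.hasDerivAt.const_mul t)).deriv
    simp only [integrand, h3, P]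
    rfl
  set ε := δ / (V + 1) with hε
  have hε0 : 0 < ε := by positivity
  have hsmall : ∀ t ∈ Metric.ball (0 : ℝ) ε, ∀ w, |w| ≤ V → |t * w| ≤ δ := by
    intro t ht w hw
    rw [mem_ball_zero_iff, Real.norm_eq_abs] at ht
    have h1 : |t| * |w| ≤ ε * (V + 1) := mul_le_mul ht.le (by linarith) (abs_nonneg _) hε0.le
    rw [abs_mul]
    exact h1.trans_eq (div_mul_cancel₀ _ (by positivity))
  have hmem : ∀ θ ∈ uIoc a b, deriv u θ ∈ Icc q₁ q₂ → ∀ t ∈ Metric.ball (0 : ℝ) ε, P t θ ∈ K := by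
    intro θ hab' hθ t ht
    rw [uIoc_of_le hab] at hab'
    have h1 := abs_le.1 (hsmall t ht _ (hV θ).1)
    have h2 := abs_le.1 (hsmall t ht _ (hV θ).2)
    have h3 := hu θ
    refine ⟨Ioc_subset_Icc_self hab', ⟨?_, ?_⟩, ?_, ?_⟩ <;> simp only [P] <;>
      linarith [h3.1, h3.2, hθ.1, hθ.2]
  have hPK : ∀ t ∈ Metric.ball (0 : ℝ) ε, ∀ᵐ θ, θ ∈ uIoc a b → P t θ ∈ K := by
    intro t ht
    filter_upwards [hu'] with θ hθ hab' using hmem θ hab' hθ t ht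
  have hmeas : ∀ t ∈ Metric.ball (0 : ℝ) ε,
      AEStronglyMeasurable (fun θ => G (P t θ)) (volume.restrict (uIoc a b)) := by
    intro t ht
    refine aestronglyMeasurable_comp_of_continuousOn hU.measurableSet hG.continuousOn (hPm t) ?_
    rw [ae_restrict_iff' measurableSet_uIoc]
    filter_upwards [hPK t ht] with θ h h' using hbox (h h')
  have hInt : ∀ t ∈ Metric.ball (0 : ℝ) ε,
      IntervalIntegrable (fun θ => G (P t θ)) volume a b := by
    intro t ht
    rw [intervalIntegrable_iff]
    refine IntegrableOn.of_bound (by simp) (hmeas t ht) B ?_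
    rw [ae_restrict_iff' measurableSet_uIoc]
    filter_upwards [hPK t ht] with θ h h' using hB _ (h h')
  have h0 : (0 : ℝ) ∈ Metric.ball (0 : ℝ) ε := Metric.mem_ball_self hε0
  have hnhds : Metric.ball (0 : ℝ) ε ∈ 𝓝 0 := Metric.ball_mem_nhds _ hε0
  have hP0 : ∀ θ, P 0 θ = (θ, u θ, deriv u θ) := fun θ => by simp [P]
  have main := intervalIntegral.hasDerivAt_integral_of_dominated_loc_of_lip (μ := volume)
    (F := fun t θ => G (P t θ))
    (F' := fun θ => fderiv ℝ G (θ, u θ, deriv u θ) (0, v θ, deriv v θ)) (a := a) (b := b)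
    (bound := fun _ => C * V) hnhds (eventually_of_mem hnhds hmeas) (hInt 0 h0) ?_ ?_
    (continuous_const.intervalIntegrable _ _) ?_
  · refine ⟨?_, main.1, ?_⟩
    · filter_upwards [hnhds] with t ht
      exact (hInt t ht).congr_ae (ae_restrict_of_ae (hint t).symm)
    · refine main.2.congr_of_eventuallyEq (Eventually.of_forall fun t => ?_)
      refine intervalIntegral.integral_congr_ae ?_
      filter_upwards [hint t] with θ h _ using h
  · refine Measurable.aestronglyMeasurable ?_
    have h1 := v.continuous.measurable
    have h2 := measurable_deriv v
    have h3 : Measurable fun θ => fderiv ℝ G (θ, u θ, deriv u θ) :=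
      (measurable_fderiv ℝ G).comp (funext hP0 ▸ hPm 0)
    have h4 : Measurable fun θ => ((0 : ℝ), v θ, deriv v θ) := by fun_prop
    exact (ContinuousLinearMap.measurable_apply₂ (𝕜 := ℝ) (E := ℝ × ℝ × ℝ) (F := ℝ)).comp
      (h3.prodMk h4)
  · filter_upwards [hu'] with θ hθ hab'
    refine LipschitzOnWith.of_dist_le_mul fun t ht s hs => ?_
    refine (hC.dist_le_mul _ (hmem θ hab' hθ t ht) _ (hmem θ hab' hθ s hs)).trans ?_
    have e : dist (P t θ) (P s θ) ≤ V * dist t s := by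
      simp only [P, Prod.dist_eq, dist_self, Real.dist_eq]
      refine max_le (by positivity) (max_le ?_ ?_)
      · rw [show u θ + t * v θ - (u θ + s * v θ) = v θ * (t - s) by ring, abs_mul]
        exact mul_le_mul_of_nonneg_right (hV θ).1 (abs_nonneg _)
      · rw [show deriv u θ + t * deriv v θ - (deriv u θ + s * deriv v θ) = deriv v θ * (t - s)
          by ring, abs_mul]
        exact mul_le_mul_of_nonneg_right (hV θ).2 (abs_nonneg _)
    rw [Real.coe_nnabs, abs_of_nonneg (mul_nonneg C.coe_nonneg hV0), mul_assoc]
    exact mul_le_mul_of_nonneg_left e C.coe_nonneg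
  · filter_upwards [hPK 0 h0] with θ hθ hab'
    have hd : HasFDerivAt G (fderiv ℝ G (P 0 θ)) (P 0 θ) :=
      ((hG.contDiffAt (hU.mem_nhds (hbox (hθ hab')))).differentiableAt one_ne_zero).hasFDerivAt
    have hl : HasDerivAt (fun t => P t θ) ((0 : ℝ), v θ, deriv v θ) 0 := by
      refine (hasDerivAt_const _ _).prodMk (HasDerivAt.prodMk ?_ ?_)
      · simpa using ((hasDerivAt_id (0 : ℝ)).mul_const (v θ)).const_add (u θ)
      · simpa using ((hasDerivAt_id (0 : ℝ)).mul_const (deriv v θ)).const_add (deriv u θ)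
    have := hd.comp_hasDerivAt (0 : ℝ) hl
    rwa [hP0] at this


theorem nonneg_of_hasDerivAt_of_forall_ge {f : ℝ → ℝ} {f' : ℝ} (h : HasDerivAt f f' 0)
    (hmin : ∀ᶠ t in 𝓝[>] 0, f 0 ≤ f t) : 0 ≤ f' := by
  refine ge_of_tendsto h.tendsto_slope_zero_right ?_
  filter_upwards [hmin, self_mem_nhdsWithin] with t ht ht0
  rw [zero_add]
  exact mul_nonneg (inv_nonneg.2 (le_of_lt ht0)) (sub_nonneg.2 ht)

/-- By lower semicontinuity and compactness, the upper constraint leaves some uniform room. -/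
theorem exists_pos_add_lt {k : ℝ → ℝ≥0∞} (hk : LowerSemicontinuous k) {u : ℝ → ℝ}
    (hu : Continuous u) {K : Set ℝ} (hK : IsCompact K)
    (h : ∀ θ ∈ K, ENNReal.ofReal (u θ) < k θ) :
    ∃ ε > 0, ∀ θ ∈ K, ENNReal.ofReal (u θ + ε) ≤ k θ := by
  have hloc : ∀ θ ∈ K, ∃ ε > 0, ∀ᶠ y in 𝓝 θ, ENNReal.ofReal (u y + ε) ≤ k y := by
    intro θ hθ
    obtain ⟨c, hc1, hc2⟩ := exists_between (h θ hθ)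
    have hcont : Continuous fun z : ℝ × ℝ => ENNReal.ofReal (u z.1 + z.2) :=
      ENNReal.continuous_ofReal.comp ((hu.comp continuous_fst).add continuous_snd)
    have hev : ∀ᶠ z : ℝ × ℝ in 𝓝 θ ×ˢ 𝓝 0, ENNReal.ofReal (u z.1 + z.2) < c := by
      rw [← nhds_prod_eq]
      exact hcont.continuousAt.eventually_lt_const (by simpa using hc1)
    obtain ⟨pa, hpa, pb, hpb, hp⟩ := eventually_prod_iff.1 hev
    obtain ⟨ε, hε, hpε⟩ := (((hpb.filter_mono nhdsWithin_le_nhds).and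
      (self_mem_nhdsWithin : Ioi (0 : ℝ) ∈ 𝓝[>] 0))).exists
    refine ⟨ε, hpε, ?_⟩
    filter_upwards [hpa, hk θ c hc2] with y hy hy'
    exact (hp hy hε).le.trans hy'.le
  choose! e he hev using hloc
  obtain ⟨t, htK, hcov⟩ := hK.elim_nhds_subcover (fun θ => {y | ENNReal.ofReal (u y + e θ) ≤ k y}) hev
  obtain ⟨ε, hε, hle⟩ : ∃ ε > 0, ∀ θ ∈ t, ε ≤ e θ := by
    rcases t.eq_empty_or_nonempty with rfl | hne
    · exact ⟨1, one_pos, by simp⟩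
    · obtain ⟨θ, hθ, hmin⟩ := t.exists_min_image e hne
      exact ⟨e θ, he θ (htK θ hθ), hmin⟩
  refine ⟨ε, hε, fun y hy => ?_⟩
  obtain ⟨θ, hθ, hyθ⟩ := mem_iUnion₂.1 (hcov hy)
  exact (ENNReal.ofReal_le_ofReal (by linarith [hle θ hθ])).trans hyθ

theorem deriv_cap_eq_zero {u : W1} {a b : ℝ} (hu : IsConvexGauge u) (hab : a < b)
    (hb : b < a + Real.pi) {θ : ℝ} (hθ : θ ∈ Ioo b (a + 2 * Real.pi)) :
    deriv (cap u a b) θ = 0 := by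
  rw [deriv_eq_of_eqOn_Ioo (g := fun _ => 0)
    (fun x hx => cap_eq_zero hu hab hb (Ioo_subset_Icc_self hx)) hθ]
  simp

/-- The caps are admissible variations: adding a small multiple of `cap u a b` respects the upper
constraint if it is not saturated on `[a, b]`. -/
theorem IsOptimal.first_variation {r : W1 → ℝ} {G : ℝ × ℝ × ℝ → ℝ} {k₁ k₂ : ℝ → ℝ≥0∞} {u : W1}
    (hu : IsOptimal r G k₁ k₂ u) (hk₂ : LowerSemicontinuous k₂)
    (hk₂p : Function.Periodic k₂ (2 * Real.pi))
    (hGp : ∀ θ x q : ℝ, 0 < x → G (θ + 2 * Real.pi, x, q) = G (θ, x, q))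
    (hr : DifferentiableAt ℝ r u) {U : Set (ℝ × ℝ × ℝ)} (hU : IsOpen U) (hG : ContDiffOn ℝ 1 G U)
    {m M q₁ q₂ a b : ℝ} (hm : m ≤ M) (hq : q₁ ≤ q₂) (hUbox : univ ×ˢ (Icc m M ×ˢ Icc q₁ q₂) ⊆ U)
    (hmM : ∀ θ, u θ ∈ Icc m M) (hu' : ∀ᵐ θ, deriv u θ ∈ Icc q₁ q₂)
    (hab : a < b) (hb : b < a + Real.pi) (hJ : Icc a b ⊆ Tin k₁ k₂ u) :
    IntervalIntegrable (fun θ => fderiv ℝ G (θ, u θ, deriv u θ) (0, cap u a b θ,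
      deriv (cap u a b) θ)) volume a b ∧
    0 ≤ fderiv ℝ r u (cap u a b) + ∫ θ in a..b, fderiv ℝ G (θ, u θ, deriv u θ)
      (0, cap u a b θ, deriv (cap u a b) θ) := by
  have hpi := Real.pi_pos
  obtain ⟨hFad, hconv, hint, hopt⟩ := hu
  have hpos : ∀ θ, 0 < u θ := fun θ => (hFad θ).2.2
  have hnn : ∀ θ, 0 ≤ u θ := fun θ => (hpos θ).le
  set v := cap u a b with hv
  obtain ⟨δ, hδ, hbox⟩ := exists_box_subset hU hm hq hUbox a (a + 2 * Real.pi)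
  obtain ⟨hI1, hI2, hI3⟩ := hasDerivAt_integral_integrand (v := v) hU hG
    (by linarith : a ≤ a + 2 * Real.pi) hδ hbox hmM hu'
  have hI2' : IntervalIntegrable (fun θ => fderiv ℝ G (θ, u θ, deriv u θ) (0, v θ, deriv v θ))
      volume a b :=
    hI2.mono_set (by rw [uIcc_of_le hab.le, uIcc_of_le (by linarith)]
                     exact Icc_subset_Icc_right (by linarith))
  have hI2'' : IntervalIntegrable (fun θ => fderiv ℝ G (θ, u θ, deriv u θ) (0, v θ, deriv v θ))
      volume b (a + 2 * Real.pi) :=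
    hI2.mono_set (by rw [uIcc_of_le (by linarith), uIcc_of_le (by linarith)]
                     exact Icc_subset_Icc_left (by linarith))
  refine ⟨hI2', ?_⟩
  have htail : ∫ θ in b..(a + 2 * Real.pi), fderiv ℝ G (θ, u θ, deriv u θ) (0, v θ, deriv v θ)
      = 0 := by
    refine (intervalIntegral.integral_congr_Ioo_of_le (g := fun _ => (0 : ℝ)) (by linarith)
      fun θ hθ => ?_).trans intervalIntegral.integral_zero
    rw [hv, cap_eq_zero hconv hab hb (Ioo_subset_Icc_self hθ), deriv_cap_eq_zero hconv hab hb hθ]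
    exact (fderiv ℝ G (θ, u θ, deriv u θ)).map_zero
  have hsplit := intervalIntegral.integral_add_adjacent_intervals hI2' hI2''
  rw [htail, add_zero] at hsplit
  rw [hsplit]
  have hline : HasDerivAt (fun t : ℝ => u + t • v) v 0 := by
    simpa using ((hasDerivAt_id (0 : ℝ)).smul_const v).const_add u
  have hrd : HasDerivAt (fun t : ℝ => r (u + t • v)) (fderiv ℝ r u v) 0 := by
    have h1 : HasFDerivAt r (fderiv ℝ r u) (u + (0 : ℝ) • v) := by
      rw [zero_smul, add_zero]; exact hr.hasFDerivAt
    exact h1.comp_hasDerivAt (0 : ℝ) hline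
  refine nonneg_of_hasDerivAt_of_forall_ge (hrd.add hI3) ?_
  obtain ⟨V, hV0, hV⟩ := v.exists_bound
  obtain ⟨ε, hε, hroom⟩ := exists_pos_add_lt hk₂ u.continuous isCompact_Icc fun θ hθ => (hJ hθ).2
  have hper : ∀ w : W1, (∀ θ, 0 < w θ) → Function.Periodic (integrand G w) (2 * Real.pi) := by
    intro w hw θ
    simp only [integrand, w.periodic θ, periodic_deriv w.periodic θ, hGp _ _ _ (hw θ)]
  have hshift : ∀ w : W1, (∀ θ, 0 < w θ) → ∫ θ in (0 : ℝ)..(2 * Real.pi), integrand G w θ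
      = ∫ θ in a..(a + 2 * Real.pi), integrand G w θ := by
    intro w hw
    have := (hper w hw).intervalIntegral_add_eq 0 a
    rwa [zero_add] at this
  have hev1 : ∀ᶠ t : ℝ in 𝓝[>] 0, t < min 1 (ε / (V + 1)) :=
    (eventually_lt_nhds (by positivity)).filter_mono nhdsWithin_le_nhds
  filter_upwards [hev1, self_mem_nhdsWithin, hI1.filter_mono nhdsWithin_le_nhds] with t ht ht0 htI
  have ht0 : 0 < t := ht0
  rw [lt_min_iff, lt_div_iff₀ (by positivity)] at ht
  have hvn : ∀ θ, 0 ≤ v θ := cap_nonneg u a b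
  have hge : ∀ θ, u θ ≤ (u + t • v) θ := fun θ =>
    le_add_of_nonneg_right (mul_nonneg ht0.le (hvn θ))
  have hpos' : ∀ θ, 0 < (u + t • v) θ := fun θ => (hpos θ).trans_le (hge θ)
  have hfad : u + t • v ∈ Fad k₁ k₂ := by
    refine fun θ => ⟨(hFad θ).1.trans (ENNReal.ofReal_le_ofReal (hge θ)), ?_, hpos' θ⟩
    have hp : Function.Periodic (fun θ => (ENNReal.ofReal ((u + t • v) θ), k₂ θ))
        (2 * Real.pi) := fun θ => by simp only [(u + t • v).periodic θ, hk₂p θ]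
    obtain ⟨y, hy, hye⟩ := hp.exists_mem_Ico (by positivity) θ a
    have h1 := congrArg Prod.fst hye
    have h2 := congrArg Prod.snd hye
    simp only at h1 h2
    rw [h1, h2]
    rcases le_total y b with hyb | hyb
    · refine le_trans (ENNReal.ofReal_le_ofReal ?_) (hroom y ⟨hy.1, hyb⟩)
      have : t * v y ≤ t * (V + 1) :=
        mul_le_mul_of_nonneg_left (by linarith [le_abs_self (v y), (hV y).1]) ht0.le
      show u y + t * v y ≤ u y + ε
      linarith
    · have h0 : v y = 0 := cap_eq_zero hconv hab hb ⟨hyb, hy.2.le⟩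
      have : (u + t • v) y = u y := by
        show u y + t * v y = u y
        rw [h0, mul_zero, add_zero]
      rw [this]
      exact (hFad y).2.1
  have hint' : IntervalIntegrable (integrand G (u + t • v)) volume 0 (2 * Real.pi) :=
    (hper _ hpos').intervalIntegrable (by positivity) htI 0 (2 * Real.pi)
  have := hopt _ hfad (isConvexGauge_add_smul_cap hconv hnn ht0.le ht.1.le) hint'
  simp only [energy, hshift _ hpos', hshift _ hpos] at this
  simpa using this

/-- A density on one period extends to a periodic function. -/
theorem exists_periodic_extension {g : ℝ → ℝ} {p : ℝ≥0∞} (hp : 1 ≤ p)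
    (hg : MemLp g p (volume.restrict (Ico 0 (2 * Real.pi)))) :
    ∃ γ : ℝ → ℝ, Function.Periodic γ (2 * Real.pi) ∧
      (∀ᵐ θ ∂(volume.restrict (Ico 0 (2 * Real.pi))), γ θ = g θ) ∧
      ∀ a b, IntervalIntegrable γ volume a b := by
  have hpi := Real.pi_pos
  set γ : ℝ → ℝ := fun θ => g (2 * Real.pi * Int.fract (θ / (2 * Real.pi))) with hγ
  have hper : Function.Periodic γ (2 * Real.pi) := by
    intro θ
    simp only [hγ]
    rw [add_div, div_self (by positivity), Int.fract_add_one]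
  have heq : ∀ θ ∈ Ico 0 (2 * Real.pi), γ θ = g θ := by
    intro θ hθ
    simp only [hγ]
    rw [Int.fract_eq_self.2 ⟨div_nonneg hθ.1 (by positivity), (div_lt_one (by positivity)).2 hθ.2⟩,
      mul_div_cancel₀ _ (by positivity)]
  have hae : ∀ᵐ θ ∂(volume.restrict (Ico 0 (2 * Real.pi))), γ θ = g θ :=
    (ae_restrict_iff' measurableSet_Ico).2 (Eventually.of_forall heq)
  refine ⟨γ, hper, hae, ?_⟩
  have hi : IntegrableOn γ (Ico 0 (2 * Real.pi)) :=
    (hg.integrable hp).congr (hae.mono fun θ h => h.symm)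
  refine hper.intervalIntegrable₀ (by positivity) ?_
  rwa [intervalIntegrable_iff_integrableOn_Ico_of_le (by positivity)]

theorem integral_mul_cap {u : W1} {a b : ℝ} (hu : IsConvexGauge u) (hab : a < b)
    (hb : b < a + Real.pi) {g γ : ℝ → ℝ} (hγp : Function.Periodic γ (2 * Real.pi))
    (hγ : ∀ᵐ θ ∂(volume.restrict (Ico 0 (2 * Real.pi))), γ θ = g θ)
    (hγi : ∀ a b, IntervalIntegrable γ volume a b) :
    ∫ θ in (0 : ℝ)..(2 * Real.pi), g θ * cap u a b θ = ∫ θ in a..b, γ θ * cap u a b θ := by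
  have hpi := Real.pi_pos
  have h1 : ∫ θ in (0 : ℝ)..(2 * Real.pi), g θ * cap u a b θ
      = ∫ θ in (0 : ℝ)..(2 * Real.pi), γ θ * cap u a b θ := by
    rw [intervalIntegral.integral_of_le (by positivity),
      intervalIntegral.integral_of_le (by positivity), ← integral_Ico_eq_integral_Ioc,
      ← integral_Ico_eq_integral_Ioc]
    exact integral_congr_ae (hγ.mono fun θ h => by simp only [h])
  have h2 : Function.Periodic (fun θ => γ θ * cap u a b θ) (2 * Real.pi) :=
    hγp.mul (cap u a b).periodic
  have h3 := h2.intervalIntegral_add_eq 0 a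
  rw [zero_add] at h3
  have h4 : ∀ c d, IntervalIntegrable (fun θ => γ θ * cap u a b θ) volume c d := fun c d =>
    (hγi c d).mul_continuousOn (cap u a b).continuous.continuousOn
  rw [h1, h3, ← intervalIntegral.integral_add_adjacent_intervals (h4 a b) (h4 b _),
    add_eq_left, ← intervalIntegral.integral_zero (μ := volume) (a := b) (b := a + 2 * Real.pi)]
  refine intervalIntegral.integral_congr_Ioo_of_le (by linarith) fun θ hθ => ?_
  rw [cap_eq_zero hu hab hb (Ioo_subset_Icc_self hθ), mul_zero]


/-! ### Decay of the mean oscillation of the derivative -/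

theorem integral_mono_of_ae_Ioo {f g : ℝ → ℝ} {a b : ℝ} (hab : a ≤ b)
    (hf : IntervalIntegrable f volume a b) (hg : IntervalIntegrable g volume a b)
    (h : ∀ᵐ x, x ∈ Ioo a b → f x ≤ g x) : ∫ x in a..b, f x ≤ ∫ x in a..b, g x := by
  simp only [intervalIntegral.integral_of_le hab, integral_Ioc_eq_integral_Ioo]
  exact setIntegral_mono_ae_restrict (hf.1.mono_set Ioo_subset_Ioc_self)
    (hg.1.mono_set Ioo_subset_Ioc_self) ((ae_restrict_iff' measurableSet_Ioo).2 h)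

/-- The slope of `u` over `[a, b]`, which is the mean of `u'`. -/
noncomputable def meanSlope (u : W1) (a b : ℝ) : ℝ := (u b - u a) / (b - a)

theorem meanSlope_mem {u : W1} {q₁ q₂ a b : ℝ} (hu' : ∀ᵐ θ, deriv u θ ∈ Icc q₁ q₂) (hab : a < b) :
    meanSlope u a b ∈ Icc q₁ q₂ := by
  have hi := (u.absolutelyContinuous a b).intervalIntegrable_deriv
  have e := (u.absolutelyContinuous a b).integral_deriv_eq_sub
  have h1 : ∫ _ in a..b, q₁ ≤ ∫ θ in a..b, deriv u θ :=
    intervalIntegral.integral_mono_ae hab.le (by simp) hi (hu'.mono fun θ h => h.1)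
  have h2 : ∫ θ in a..b, deriv u θ ≤ ∫ _ in a..b, q₂ :=
    intervalIntegral.integral_mono_ae hab.le hi (by simp) (hu'.mono fun θ h => h.2)
  rw [intervalIntegral.integral_const, smul_eq_mul, e] at h1 h2
  have hba : 0 < b - a := sub_pos.2 hab
  exact ⟨(le_div_iff₀ hba).2 (by linarith), (div_le_iff₀ hba).2 (by linarith)⟩

theorem ae_deriv_cap {u : W1} {a b : ℝ} (hu : IsConvexGauge u) (hab : a < b)
    (hb : b < a + Real.pi) :
    ∀ᵐ θ, θ ∈ Ioo a b → deriv (cap u a b) θ = deriv (chord u a b) θ - deriv u θ := by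
  filter_upwards [u.ae_differentiableAt] with θ hθ hθI
  rw [deriv_eq_of_eqOn_Ioo (g := fun θ => chord u a b θ - u θ)
    (fun x hx => cap_eq_sub hu hab hb (Ioo_subset_Icc_self hx)) hθI]
  exact deriv_fun_sub (hasDerivAt_chord u a b θ).differentiableAt hθ

theorem cap_left {u : W1} {a b : ℝ} (hu : IsConvexGauge u) (hab : a < b) (hb : b < a + Real.pi) :
    cap u a b a = 0 := by
  rw [cap_eq_sub hu hab hb (left_mem_Icc.2 hab.le),
    chord_left (Real.sin_pos_of_pos_of_lt_pi (by linarith) (by linarith)), sub_self]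

theorem cap_right {u : W1} {a b : ℝ} (hu : IsConvexGauge u) (hab : a < b) (hb : b < a + Real.pi) :
    cap u a b b = 0 := by
  rw [cap_eq_sub hu hab hb (right_mem_Icc.2 hab.le),
    chord_right (Real.sin_pos_of_pos_of_lt_pi (by linarith) (by linarith)), sub_self]

theorem intervalIntegrable_deriv_sub_sq (u : W1) (q a b : ℝ) :
    IntervalIntegrable (fun θ => (deriv u θ - q) ^ 2) volume a b := by
  have h1 := u.intervalIntegrable_deriv_mul u a b
  have h2 := (u.absolutelyContinuous a b).intervalIntegrable_deriv
  refine ((h1.sub (h2.const_mul (2 * q))).add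
    (intervalIntegrable_const (c := q ^ 2))).congr (fun θ _ => ?_)
  ring

theorem intervalIntegrable_abs_deriv_sub (u : W1) (q a b : ℝ) :
    IntervalIntegrable (fun θ => |deriv u θ - q|) volume a b :=
  ((u.absolutelyContinuous a b).intervalIntegrable_deriv.sub intervalIntegrable_const).abs

theorem abs_deriv_cap_le {u : W1} {M a b : ℝ} (hu : IsConvexGauge u) (h0 : ∀ θ, 0 ≤ u θ)
    (hM : ∀ θ, u θ ≤ M) (hab : a < b) (hb : b ≤ a + 1) :
    ∀ᵐ θ, θ ∈ Ioo a b → |deriv (cap u a b) θ - (meanSlope u a b - deriv u θ)|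
      ≤ 2 * M * (b - a) := by
  have hpi := Real.pi_gt_three
  filter_upwards [ae_deriv_cap hu hab (by linarith)] with θ hθ hI
  rw [hθ hI, show ∀ x y z : ℝ, x - y - (z - y) = x - z from fun x y z => by ring]
  exact abs_deriv_chord_sub_le h0 hM hab (by linarith) (Ioo_subset_Icc_self hI)

theorem cap_le {u : W1} {M a b : ℝ} (hu : IsConvexGauge u) (h0 : ∀ θ, 0 ≤ u θ)
    (hM : ∀ θ, u θ ≤ M) (hab : a < b) (hb : b ≤ a + 1) {θ : ℝ} (hθ : θ ∈ Icc a b) :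
    cap u a b θ ≤ (∫ s in a..b, |deriv u s - meanSlope u a b|) + 2 * M * (b - a) ^ 2 := by
  have hpi := Real.pi_gt_three
  set v := cap u a b
  have e := (v.absolutelyContinuous a θ).integral_deriv_eq_sub
  rw [cap_left hu hab (by linarith), sub_zero] at e
  have hi : IntervalIntegrable (fun s => |deriv u s - meanSlope u a b| + 2 * M * (b - a))
      volume a b := (intervalIntegrable_abs_deriv_sub u _ a b).add intervalIntegrable_const
  have hi' : IntervalIntegrable (fun s => |deriv v s|) volume a b :=
    (v.absolutelyContinuous a b).intervalIntegrable_deriv.abs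
  calc v θ = ∫ s in a..θ, deriv v s := e.symm
    _ ≤ ∫ s in a..θ, |deriv v s| := (le_abs_self _).trans
        (intervalIntegral.abs_integral_le_integral_abs hθ.1)
    _ ≤ ∫ s in a..b, |deriv v s| := by
        refine intervalIntegral.integral_mono_interval le_rfl hθ.1 hθ.2 ?_ hi'
        exact Eventually.of_forall fun s => abs_nonneg _
    _ ≤ ∫ s in a..b, (|deriv u s - meanSlope u a b| + 2 * M * (b - a)) := by
        refine integral_mono_of_ae_Ioo hab.le hi' hi ?_
        filter_upwards [abs_deriv_cap_le hu h0 hM hab hb] with s hs hsI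
        have h1 := hs hsI
        have h2 := abs_add_le (deriv v s - (meanSlope u a b - deriv u s))
          (meanSlope u a b - deriv u s)
        rw [sub_add_cancel, abs_sub_comm (meanSlope u a b)] at h2
        linarith
    _ = _ := by
        rw [intervalIntegral.integral_add (intervalIntegrable_abs_deriv_sub u _ a b)
          intervalIntegrable_const, intervalIntegral.integral_const, smul_eq_mul]
        ring

/-- The pointwise inequality behind the excess estimate: `D` is the differential of the integrand,
`c` its modulus of convexity in `q`, `w` the slope of the chord and `k` the mean slope. -/
theorem variation_integrand_le {D : ℝ × ℝ × ℝ → (ℝ × ℝ × ℝ →L[ℝ] ℝ)} {K : Set (ℝ × ℝ × ℝ)}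
    {N c M C ℓ : ℝ} {L : ℝ≥0} (hN : ∀ z ∈ K, ‖D z‖ ≤ N) (hL : LipschitzOnWith L D K)
    (hc : ∀ θ x q q', (θ, x, q) ∈ K → (θ, x, q') ∈ K →
      c * (q - q') ^ 2 ≤ (D (θ, x, q) (0, 0, 1) - D (θ, x, q') (0, 0, 1)) * (q - q'))
    (hM : 0 ≤ M) (hC : 0 ≤ C) (hℓ : 0 ≤ ℓ) {θ θ₀ x x₀ q k v v' : ℝ}
    (hz : (θ, x, q) ∈ K) (hz1 : (θ, x, k) ∈ K) (hz0 : (θ₀, x₀, k) ∈ K) (hθ : |θ - θ₀| ≤ ℓ)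
    (hx : |x - x₀| ≤ C * ℓ) (hv : 0 ≤ v) (hv' : |v' - (k - q)| ≤ 2 * M * ℓ) :
    D (θ, x, q) (0, v, v') - D (θ₀, x₀, k) (0, 0, 1) * v'
      ≤ N * v - c * (q - k) ^ 2 + L * (1 + C) * (1 + 2 * M) * (ℓ * |q - k| + ℓ ^ 2) := by
  have hdiff : ∀ z ∈ K, ∀ z' ∈ K, |D z (0, 0, 1) - D z' (0, 0, 1)| ≤ L * dist z z' := by
    intro z hz z' hz'
    have h1 := (D z - D z').le_opNorm ((0 : ℝ), (0 : ℝ), (1 : ℝ))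
    have h2 : ‖((0 : ℝ), (0 : ℝ), (1 : ℝ))‖ = 1 := by simp [Prod.norm_def]
    rw [h2, mul_one, ← dist_eq_norm, Real.norm_eq_abs] at h1
    exact h1.trans (hL.dist_le_mul z hz z' hz')
  have hlin : D (θ, x, q) (0, v, v') = D (θ, x, q) (0, v, 0) + v' * D (θ, x, q) (0, 0, 1) := by
    rw [← smul_eq_mul, ← map_smul, ← map_add]
    simp
  have hfirst : D (θ, x, q) (0, v, 0) ≤ N * v := by
    have h1 := (D (θ, x, q)).le_opNorm ((0 : ℝ), v, (0 : ℝ))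
    have h2 : ‖((0 : ℝ), v, (0 : ℝ))‖ = v := by simp [Prod.norm_def, hv]
    rw [h2] at h1
    exact (le_abs_self _).trans (h1.trans (mul_le_mul_of_nonneg_right (hN _ hz) hv))
  set A := D (θ, x, q) (0, 0, 1)
  set A₁ := D (θ, x, k) (0, 0, 1)
  set A₀ := D (θ₀, x₀, k) (0, 0, 1)
  have e1 : c * (q - k) ^ 2 ≤ (A - A₁) * (q - k) := hc _ _ _ _ hz hz1
  have e2 : |A₁ - A₀| ≤ L * ((1 + C) * ℓ) := by
    refine (hdiff _ hz1 _ hz0).trans (mul_le_mul_of_nonneg_left ?_ L.coe_nonneg)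
    simp only [Prod.dist_eq, dist_self, Real.dist_eq]
    have := mul_nonneg hC hℓ
    exact max_le (by linarith) (max_le (by linarith) (by positivity))
  have e3 : |A - A₁| ≤ L * |q - k| := by
    refine (hdiff _ hz _ hz1).trans_eq ?_
    simp [Prod.dist_eq, Real.dist_eq]
  have hL0 := L.coe_nonneg
  have e4 : (A - A₀) * v' = - ((A - A₁) * (q - k)) - (A₁ - A₀) * (q - k)
      + ((A - A₁) + (A₁ - A₀)) * (v' - (k - q)) := by ring
  have e5 : -((A₁ - A₀) * (q - k)) ≤ L * ((1 + C) * ℓ) * |q - k| := by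
    refine (neg_le_abs _).trans ?_
    rw [abs_mul]
    exact mul_le_mul_of_nonneg_right e2 (abs_nonneg _)
  have e6 : ((A - A₁) + (A₁ - A₀)) * (v' - (k - q))
      ≤ (L * |q - k| + L * ((1 + C) * ℓ)) * (2 * M * ℓ) := by
    refine (le_abs_self _).trans ?_
    rw [abs_mul]
    exact mul_le_mul ((abs_add_le _ _).trans (add_le_add e3 e2)) hv' (abs_nonneg _) (by positivity)
  have hd := abs_nonneg (q - k)
  have n1 : 0 ≤ L * C * (2 * M) * (ℓ * |q - k|) := by positivity
  have n2 : 0 ≤ L * (1 + C) * ℓ ^ 2 := by positivity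
  rw [hlin]
  nlinarith

/-- The variational inequality for the cap over `[a, b]` bounds the mean square oscillation of `u'`
on `[a, b]`. -/
theorem integral_sq_le_of_variation {u : W1} {M C : ℝ} (hu : IsConvexGauge u) (h0 : ∀ θ, 0 ≤ u θ)
    (hM : ∀ θ, u θ ≤ M) (hC : ∀ x y, |u x - u y| ≤ C * |x - y|)
    {D : ℝ × ℝ × ℝ → (ℝ × ℝ × ℝ →L[ℝ] ℝ)} {K : Set (ℝ × ℝ × ℝ)} {N c q₁ q₂ a b : ℝ} {L : ℝ≥0}
    (hc0 : 0 < c) (hC0 : 0 ≤ C) (hN0 : 0 ≤ N) (hN : ∀ z ∈ K, ‖D z‖ ≤ N) (hL : LipschitzOnWith L D K)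
    (hc : ∀ θ x q q', (θ, x, q) ∈ K → (θ, x, q') ∈ K →
      c * (q - q') ^ 2 ≤ (D (θ, x, q) (0, 0, 1) - D (θ, x, q') (0, 0, 1)) * (q - q'))
    (hab : a < b) (hb : b ≤ a + 1) (hu' : ∀ᵐ θ, deriv u θ ∈ Icc q₁ q₂)
    (hK : ∀ θ ∈ Icc a b, ∀ q ∈ Icc q₁ q₂, (θ, u θ, q) ∈ K) {γ : ℝ → ℝ}
    (hγ : IntervalIntegrable γ volume a b)
    (hi : IntervalIntegrable (fun θ => D (θ, u θ, deriv u θ) (0, cap u a b θ, deriv (cap u a b) θ))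
      volume a b)
    (hvar : 0 ≤ (∫ θ in a..b, γ θ * cap u a b θ) +
      ∫ θ in a..b, D (θ, u θ, deriv u θ) (0, cap u a b θ, deriv (cap u a b) θ))
    {C₁ : ℝ} (hC₁ : C₁ = (1 + N) * (1 + 2 * M) + L * (1 + C) * (1 + 2 * M)) :
    ∫ θ in a..b, (deriv u θ - meanSlope u a b) ^ 2
      ≤ 2 / c * (C₁ + C₁ ^ 2 / (2 * c)) * (b - a) * (∫ θ in a..b, (1 + |γ θ|)) ^ 2 := by
  have hpi := Real.pi_gt_three
  have hM0 : 0 ≤ M := (h0 0).trans (hM 0)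
  set v := cap u a b with hv
  set k := meanSlope u a b with hk
  set ℓ := b - a with hℓ
  have hℓ0 : 0 < ℓ := sub_pos.2 hab
  set E := L * (1 + C) * (1 + 2 * M) with hE
  have hE0 : 0 ≤ E := by positivity
  set A := ∫ θ in a..b, |deriv u θ - k| with hA
  set Q := ∫ θ in a..b, (deriv u θ - k) ^ 2 with hQ
  set Λ := ∫ θ in a..b, (1 + |γ θ|) with hΛ
  set S := A + 2 * M * ℓ ^ 2 with hS
  have hkmem : k ∈ Icc q₁ q₂ := meanSlope_mem hu' hab
  have iA := intervalIntegrable_abs_deriv_sub u k a b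
  have iQ := intervalIntegrable_deriv_sub_sq u k a b
  have iv' : IntervalIntegrable (deriv v) volume a b :=
    (v.absolutelyContinuous a b).intervalIntegrable_deriv
  have iγv : IntervalIntegrable (fun θ => γ θ * v θ) volume a b :=
    hγ.mul_continuousOn v.continuous.continuousOn
  have iΛ : IntervalIntegrable (fun θ => 1 + |γ θ|) volume a b :=
    intervalIntegrable_const.add hγ.abs
  have hA0 : 0 ≤ A := intervalIntegral.integral_nonneg hab.le fun θ _ => abs_nonneg _
  have hS0 : 0 ≤ S := by positivity
  have hℓΛ : ℓ ≤ Λ := by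
    have := intervalIntegral.integral_mono (μ := volume) hab.le
      (intervalIntegrable_const (c := (1 : ℝ))) iΛ (fun θ => by simp)
    rwa [intervalIntegral.integral_const, smul_eq_mul, mul_one] at this
  set D₀ := D (a, u a, k) (0, 0, 1) with hD₀
  have hv'0 : ∫ θ in a..b, D₀ * deriv v θ = 0 := by
    rw [intervalIntegral.integral_const_mul, (v.absolutelyContinuous a b).integral_deriv_eq_sub, hv,
      cap_right hu hab (by linarith), cap_left hu hab (by linarith), sub_self, mul_zero]
  have hpt : ∀ᵐ θ, θ ∈ Ioo a b →
      γ θ * v θ + (D (θ, u θ, deriv u θ) (0, v θ, deriv v θ) - D₀ * deriv v θ)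
      ≤ (1 + N) * S * (1 + |γ θ|) - c * (deriv u θ - k) ^ 2 + E * ℓ * |deriv u θ - k|
        + E * ℓ ^ 2 := by
    filter_upwards [hu', abs_deriv_cap_le hu h0 hM hab hb] with θ h1 h2 hθ
    have hθ' := Ioo_subset_Icc_self hθ
    have hv0 : 0 ≤ v θ := cap_nonneg u a b θ
    have hvS : v θ ≤ S := cap_le hu h0 hM hab hb hθ'
    have hdist : |θ - a| ≤ ℓ := by
      rw [abs_of_nonneg (by linarith [hθ.1])]; linarith [hθ.2]
    have := variation_integrand_le hN hL hc hM0 hC0 hℓ0.le (hK θ hθ' _ h1)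
      (hK θ hθ' _ hkmem) (hK a (left_mem_Icc.2 hab.le) _ hkmem) hdist
      ((hC θ a).trans (mul_le_mul_of_nonneg_left hdist hC0)) hv0 (h2 hθ)
    have h3 : γ θ * v θ ≤ |γ θ| * S :=
      mul_le_mul (le_abs_self _) hvS hv0 (abs_nonneg _)
    have h4 : N * v θ ≤ N * S := mul_le_mul_of_nonneg_left hvS hN0
    have h5 : 0 ≤ N * (S * |γ θ|) := by positivity
    linarith
  have hineq := integral_mono_of_ae_Ioo hab.le (iγv.add (hi.sub (iv'.const_mul D₀)))
    ((((iΛ.const_mul ((1 + N) * S)).sub (iQ.const_mul c)).add (iA.const_mul (E * ℓ))).add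
      (intervalIntegrable_const (c := E * ℓ ^ 2))) hpt
  rw [intervalIntegral.integral_add iγv (hi.sub (iv'.const_mul D₀)),
    intervalIntegral.integral_sub hi (iv'.const_mul D₀), hv'0, sub_zero,
    intervalIntegral.integral_add
      (((iΛ.const_mul ((1 + N) * S)).sub (iQ.const_mul c)).add (iA.const_mul (E * ℓ)))
      intervalIntegrable_const,
    intervalIntegral.integral_add ((iΛ.const_mul ((1 + N) * S)).sub (iQ.const_mul c))
      (iA.const_mul (E * ℓ)),
    intervalIntegral.integral_sub (iΛ.const_mul ((1 + N) * S)) (iQ.const_mul c),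
    intervalIntegral.integral_const_mul, intervalIntegral.integral_const_mul,
    intervalIntegral.integral_const_mul, intervalIntegral.integral_const, smul_eq_mul] at hineq
  -- Young's inequality absorbs the linear term `A` into the quadratic term `Q`.
  have hyoung : C₁ * Λ * A ≤ c / 2 * Q + C₁ ^ 2 / (2 * c) * Λ ^ 2 * ℓ := by
    have h1 : ∫ θ in a..b, C₁ * Λ * |deriv u θ - k|
        ≤ ∫ θ in a..b, (c / 2 * (deriv u θ - k) ^ 2 + C₁ ^ 2 / (2 * c) * Λ ^ 2) := by
      refine intervalIntegral.integral_mono hab.le (iA.const_mul _)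
        ((iQ.const_mul _).add intervalIntegrable_const) fun θ => ?_
      have h2 : 0 ≤ (c * |deriv u θ - k| - C₁ * Λ) ^ 2 / (2 * c) := by positivity
      have h3 : (c * |deriv u θ - k| - C₁ * Λ) ^ 2 / (2 * c) = c / 2 * |deriv u θ - k| ^ 2
          + C₁ ^ 2 / (2 * c) * Λ ^ 2 - C₁ * Λ * |deriv u θ - k| := by
        field_simp; ring
      simp only
      rw [← sq_abs (deriv u θ - k)]
      linarith
    rw [intervalIntegral.integral_const_mul, intervalIntegral.integral_add (iQ.const_mul _)
      intervalIntegrable_const, intervalIntegral.integral_const_mul,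
      intervalIntegral.integral_const, smul_eq_mul] at h1
    linarith
  have hΛ0 : 0 ≤ Λ := hℓ0.le.trans hℓΛ
  have hfin : c * Q ≤ C₁ * Λ * A + C₁ * ℓ * Λ ^ 2 := by
    have m1 : ℓ ^ 2 ≤ ℓ * Λ := by rw [sq]; exact mul_le_mul_of_nonneg_left hℓΛ hℓ0.le
    have m2 : (1 + N) * (2 * M) * Λ * ℓ ^ 2 ≤ (1 + N) * (2 * M) * Λ * (ℓ * Λ) :=
      mul_le_mul_of_nonneg_left m1 (by positivity)
    have m3 : E * A * ℓ ≤ E * A * Λ := mul_le_mul_of_nonneg_left hℓΛ (by positivity)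
    have m4 : E * ℓ * ℓ ^ 2 ≤ E * ℓ * Λ ^ 2 :=
      mul_le_mul_of_nonneg_left (pow_le_pow_left₀ hℓ0.le hℓΛ 2) (by positivity)
    have m5 : 0 ≤ (1 + N) * (2 * M) * (Λ * A) := by positivity
    have m6 : 0 ≤ (1 + N) * (ℓ * Λ ^ 2) := by positivity
    rw [hC₁]
    have hvar' := hvar.trans hineq
    rw [hS] at hvar'
    linarith
  have hlast : c / 2 * Q ≤ (C₁ + C₁ ^ 2 / (2 * c)) * ℓ * Λ ^ 2 := by linarith
  have : Q ≤ 2 / c * ((C₁ + C₁ ^ 2 / (2 * c)) * ℓ * Λ ^ 2) := by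
    rw [div_mul_eq_mul_div, le_div_iff₀ hc0]
    linarith
  linarith


/-- Bounds for a `C²` integrand on a compact box: a bound and a Lipschitz constant of its
differential, and a modulus of convexity in the last variable. -/
theorem exists_integrand_bounds {G : ℝ × ℝ × ℝ → ℝ} {U : Set (ℝ × ℝ × ℝ)} (hU : IsOpen U)
    (hG : ContDiffOn ℝ 2 G U) {α β m M q₁ q₂ : ℝ}
    (hKU : Icc α β ×ˢ (Icc m M ×ˢ Icc q₁ q₂) ⊆ U)
    (hGqq : ∀ θ x q : ℝ, (θ, x, q) ∈ Icc α β ×ˢ (Icc m M ×ˢ Icc q₁ q₂) →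
      0 < iteratedDeriv 2 (fun s : ℝ => G (θ, x, s)) q) :
    ∃ (c N : ℝ) (L : ℝ≥0), 0 < c ∧ 0 ≤ N ∧
      (∀ z ∈ Icc α β ×ˢ (Icc m M ×ˢ Icc q₁ q₂), ‖fderiv ℝ G z‖ ≤ N) ∧
      LipschitzOnWith L (fderiv ℝ G) (Icc α β ×ˢ (Icc m M ×ˢ Icc q₁ q₂)) ∧
      ∀ θ x q q', (θ, x, q) ∈ Icc α β ×ˢ (Icc m M ×ˢ Icc q₁ q₂) →
        (θ, x, q') ∈ Icc α β ×ˢ (Icc m M ×ˢ Icc q₁ q₂) → c * (q - q') ^ 2 ≤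
        (fderiv ℝ G (θ, x, q) (0, 0, 1) - fderiv ℝ G (θ, x, q') (0, 0, 1)) * (q - q') := by
  set K := Icc α β ×ˢ (Icc m M ×ˢ Icc q₁ q₂) with hK
  have hKc : IsCompact K := isCompact_Icc.prod (isCompact_Icc.prod isCompact_Icc)
  have hKconv : Convex ℝ K := (convex_Icc _ _).prod ((convex_Icc _ _).prod (convex_Icc _ _))
  have hD : ContDiffOn ℝ 1 (fderiv ℝ G) U := hG.fderiv_of_isOpen hU (by norm_num)
  obtain ⟨L, hL⟩ := (hD.mono hKU).exists_lipschitzOnWith one_ne_zero hKconv hKc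
  obtain ⟨N, hN⟩ := hKc.exists_bound_of_continuousOn (hD.continuousOn.mono hKU)
  have hline : ∀ θ x q : ℝ, HasDerivAt (fun s : ℝ => (θ, x, s)) ((0 : ℝ), (0 : ℝ), (1 : ℝ)) q :=
    fun θ x q => (hasDerivAt_const _ _).prodMk ((hasDerivAt_const _ _).prodMk (hasDerivAt_id q))
  have hGq : ∀ θ x q : ℝ, (θ, x, q) ∈ U →
      HasDerivAt (fun s : ℝ => G (θ, x, s)) (fderiv ℝ G (θ, x, q) (0, 0, 1)) q := by
    intro θ x q hz
    exact ((hG.contDiffAt (hU.mem_nhds hz)).differentiableAt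
      two_ne_zero).hasFDerivAt.comp_hasDerivAt q (hline θ x q)
  set H : ℝ × ℝ × ℝ → ℝ := fun z => fderiv ℝ (fderiv ℝ G) z (0, 0, 1) (0, 0, 1) with hH
  have hDq : ∀ θ x q : ℝ, (θ, x, q) ∈ U →
      HasDerivAt (fun s : ℝ => fderiv ℝ G (θ, x, s) (0, 0, 1)) (H (θ, x, q)) q := by
    intro θ x q hz
    have h1 : HasDerivAt (fun s : ℝ => fderiv ℝ G (θ, x, s))
        (fderiv ℝ (fderiv ℝ G) (θ, x, q) (0, 0, 1)) q :=
      ((hD.contDiffAt (hU.mem_nhds hz)).differentiableAt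
        one_ne_zero).hasFDerivAt.comp_hasDerivAt q (hline θ x q)
    have h2 := h1.clm_apply (hasDerivAt_const q ((0 : ℝ), (0 : ℝ), (1 : ℝ)))
    rwa [ContinuousLinearMap.map_zero, add_zero] at h2
  have hHeq : ∀ θ x q : ℝ, (θ, x, q) ∈ U →
      iteratedDeriv 2 (fun s : ℝ => G (θ, x, s)) q = H (θ, x, q) := by
    intro θ x q hz
    rw [iteratedDeriv_succ, iteratedDeriv_one]
    have hev : ∀ᶠ s in 𝓝 q, (θ, x, s) ∈ U :=
      (hline θ x q).continuousAt.eventually_mem (hU.mem_nhds hz)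
    have : deriv (fun s : ℝ => G (θ, x, s)) =ᶠ[𝓝 q] fun s => fderiv ℝ G (θ, x, s) (0, 0, 1) :=
      hev.mono fun s hs => (hGq θ x s hs).deriv
    rw [this.deriv_eq]
    exact (hDq θ x q hz).deriv
  have hHc : ContinuousOn H U :=
    ((hD.continuousOn_fderiv_of_isOpen hU le_rfl).clm_apply continuousOn_const).clm_apply
      continuousOn_const
  obtain ⟨c, hc0, hc⟩ : ∃ c > 0, ∀ z ∈ K, c ≤ H z := by
    rcases K.eq_empty_or_nonempty with he | hne
    · exact ⟨1, one_pos, by simp [he]⟩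
    · obtain ⟨z, hz, hmin⟩ := hKc.exists_isMinOn hne (hHc.mono hKU)
      refine ⟨H z, ?_, fun y hy => hmin hy⟩
      obtain ⟨θ, x, q⟩ := z
      rw [← hHeq θ x q (hKU hz)]
      exact hGqq θ x q hz
  refine ⟨c, max N 0, L, hc0, le_max_right _ _, fun z hz => (hN z hz).trans (le_max_left _ _), hL,
    ?_⟩
  have key : ∀ θ x q q', (θ, x, q) ∈ K → (θ, x, q') ∈ K → q ≤ q' →
      c * (q' - q) ≤ fderiv ℝ G (θ, x, q') (0, 0, 1) - fderiv ℝ G (θ, x, q) (0, 0, 1) := by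
    intro θ x q q' hz hz' hqq'
    have hmem : ∀ s ∈ Icc q₁ q₂, (θ, x, s) ∈ K := fun s hs => ⟨hz.1, hz.2.1, hs⟩
    refine (convex_Icc q₁ q₂).mul_sub_le_image_sub_of_le_deriv
      (f := fun s => fderiv ℝ G (θ, x, s) (0, 0, 1))
      (fun s hs => (hDq θ x s (hKU (hmem s hs))).continuousAt.continuousWithinAt)
      (fun s hs => (hDq θ x s (hKU (hmem s (interior_subset
        hs)))).differentiableAt.differentiableWithinAt)
      (fun s hs => ?_) q hz.2.2 q' hz'.2.2 hqq'
    rw [(hDq θ x s (hKU (hmem s (interior_subset hs)))).deriv]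
    exact hc _ (hmem s (interior_subset hs))
  intro θ x q q' hz hz'
  rcases le_total q q' with h | h
  · have := mul_le_mul_of_nonneg_right (key θ x q q' hz hz' h) (sub_nonneg.2 h)
    linarith
  · have := mul_le_mul_of_nonneg_right (key θ x q' q hz' hz h) (sub_nonneg.2 h)
    linarith

theorem exists_int_shift (a : ℝ) : ∃ n : ℤ, a - n * (2 * Real.pi) ∈ Ico 0 (2 * Real.pi) := by
  obtain ⟨n, hn, -⟩ := existsUnique_sub_zsmul_mem_Ico Real.two_pi_pos a 0
  exact ⟨n, by simpa using hn⟩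

theorem integral_int_shift {f : ℝ → ℝ} (hf : Function.Periodic f (2 * Real.pi)) (n : ℤ)
    (a b : ℝ) :
    ∫ θ in (a - n * (2 * Real.pi))..(b - n * (2 * Real.pi)), f θ = ∫ θ in a..b, f θ := by
  rw [← intervalIntegral.integral_comp_sub_right]
  congr 1
  ext θ
  exact (hf.int_mul n).sub_eq θ

theorem Tin_int_shift {k₁ k₂ : ℝ → ℝ≥0∞} (hk₁p : Function.Periodic k₁ (2 * Real.pi))
    (hk₂p : Function.Periodic k₂ (2 * Real.pi)) (u : W1) (n : ℤ) {a b : ℝ}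
    (h : Icc a b ⊆ Tin k₁ k₂ u) :
    Icc (a - n * (2 * Real.pi)) (b - n * (2 * Real.pi)) ⊆ Tin k₁ k₂ u := by
  intro θ hθ
  have h1 := h (a := θ + n * (2 * Real.pi)) ⟨by linarith [hθ.1], by linarith [hθ.2]⟩
  simpa only [Tin, mem_ofPred_eq, hk₁p.int_mul n θ, hk₂p.int_mul n θ, u.periodic.int_mul n θ] using h1

/-- On short intervals inside `𝕋_in`, the mean square oscillation of `u'` is at most a multiple of
`(∫ (1 + |γ|))²`, where `γ` is the density of `r'(u)`. -/
theorem IsOptimal.exists_excess_bound {r : W1 → ℝ} {G : ℝ × ℝ × ℝ → ℝ} {k₁ k₂ : ℝ → ℝ≥0∞} {u : W1}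
    (hu : IsOptimal r G k₁ k₂ u) (hk₂ : LowerSemicontinuous k₂)
    (hk₁p : Function.Periodic k₁ (2 * Real.pi)) (hk₂p : Function.Periodic k₂ (2 * Real.pi))
    (hGp : ∀ θ x q : ℝ, 0 < x → G (θ + 2 * Real.pi, x, q) = G (θ, x, q))
    (hr : DifferentiableAt ℝ r u) {U : Set (ℝ × ℝ × ℝ)} (hU : IsOpen U) (hGU : graphBox u ⊆ U)
    (hG : ContDiffOn ℝ 2 G U)
    (hGqq : ∀ θ x q : ℝ, (θ, x, q) ∈ graphBox u →
      0 < iteratedDeriv 2 (fun s : ℝ => G (θ, x, s)) q)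
    {g γ : ℝ → ℝ} (hγp : Function.Periodic γ (2 * Real.pi))
    (hγ : ∀ᵐ θ ∂(volume.restrict (Ico 0 (2 * Real.pi))), γ θ = g θ)
    (hγi : ∀ a b, IntervalIntegrable γ volume a b)
    (hg : ∀ v : W1, fderiv ℝ r u v = ∫ θ in (0 : ℝ)..(2 * Real.pi), g θ * v θ) :
    ∃ C, 0 ≤ C ∧ ∀ a b, a < b → b ≤ a + 1 → Icc a b ⊆ Tin k₁ k₂ u →
      ∫ θ in a..b, (deriv u θ - meanSlope u a b) ^ 2
        ≤ C * (b - a) * (∫ θ in a..b, (1 + |γ θ|)) ^ 2 := by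
  have hpi := Real.pi_gt_three
  obtain ⟨m, M, hm, hrange⟩ := u.exists_range_eq
  obtain ⟨q₁, q₂, hq, hconvD⟩ := u.exists_convDeriv_eq
  have hbox : graphBox u = univ ×ˢ (Icc m M ×ˢ Icc q₁ q₂) := by rw [graphBox, hrange, hconvD]
  rw [hbox] at hGU hGqq
  have hmM : ∀ θ, u θ ∈ Icc m M := fun θ => hrange ▸ mem_range_self θ
  have hu' : ∀ᵐ θ, deriv u θ ∈ Icc q₁ q₂ := hconvD ▸ u.deriv_mem_convDeriv
  have h0 : ∀ θ, 0 ≤ u θ := fun θ => (hu.1 θ).2.2.le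
  have hM : ∀ θ, u θ ≤ M := fun θ => (hmM θ).2
  have hM0 : 0 ≤ M := (h0 0).trans (hM 0)
  obtain ⟨Cu, hCu⟩ := u.exists_lipschitz
  have hsub : Icc 0 (2 * Real.pi + 1) ×ˢ (Icc m M ×ˢ Icc q₁ q₂)
      ⊆ (univ : Set ℝ) ×ˢ (Icc m M ×ˢ Icc q₁ q₂) := prod_mono_left (subset_univ _)
  obtain ⟨c, N, L, hc0, hN0, hN, hL, hc⟩ := exists_integrand_bounds hU hG (hsub.trans hGU)
    fun θ x q h => hGqq θ x q (hsub h)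
  refine ⟨2 / c * (((1 + N) * (1 + 2 * M) + L * (1 + Cu) * (1 + 2 * M))
    + ((1 + N) * (1 + 2 * M) + L * (1 + Cu) * (1 + 2 * M)) ^ 2 / (2 * c)), by positivity, ?_⟩
  have main : ∀ a b, 0 ≤ a → a ≤ 2 * Real.pi → a < b → b ≤ a + 1 → Icc a b ⊆ Tin k₁ k₂ u →
      ∫ θ in a..b, (deriv u θ - meanSlope u a b) ^ 2
        ≤ 2 / c * (((1 + N) * (1 + 2 * M) + L * (1 + Cu) * (1 + 2 * M))
    + ((1 + N) * (1 + 2 * M) + L * (1 + Cu) * (1 + 2 * M)) ^ 2 / (2 * c)) * (b - a)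
          * (∫ θ in a..b, (1 + |γ θ|)) ^ 2 := by
    intro a b ha ha' hab hb hJ
    obtain ⟨hi, hvar⟩ := hu.first_variation hk₂ hk₂p hGp hr hU (hG.of_le (by norm_num)) hm hq hGU
      hmM hu' hab (by linarith) hJ
    rw [hg, integral_mul_cap hu.2.1 hab (by linarith) hγp hγ hγi] at hvar
    refine integral_sq_le_of_variation hu.2.1 h0 hM
      (fun x y => by simpa only [Real.dist_eq] using hCu.dist_le_mul x y) hc0
      Cu.coe_nonneg hN0 hN hL hc hab hb hu' (fun θ hθ q hq => ?_) (hγi a b) hi hvar rfl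
    exact ⟨⟨ha.trans hθ.1, hθ.2.trans (by linarith)⟩, hmM θ, hq⟩
  intro a b hab hb hJ
  obtain ⟨n, hn⟩ := exists_int_shift a
  have := main _ (b - n * (2 * Real.pi)) hn.1 hn.2.le (by linarith) (by linarith)
    (Tin_int_shift hk₁p hk₂p u n hJ)
  have hk : meanSlope u (a - n * (2 * Real.pi)) (b - n * (2 * Real.pi)) = meanSlope u a b := by
    rw [meanSlope, meanSlope, (u.periodic.int_mul n).sub_eq, (u.periodic.int_mul n).sub_eq]
    congr 1
    ring
  have p1 : Function.Periodic (fun θ => (deriv u θ - meanSlope u a b) ^ 2) (2 * Real.pi) :=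
    fun θ => by simp only [periodic_deriv u.periodic θ]
  have p2 : Function.Periodic (fun θ => 1 + |γ θ|) (2 * Real.pi) := fun θ => by simp only [hγp θ]
  rw [hk, integral_int_shift p1, integral_int_shift p2] at this
  convert this using 2
  ring

/-! ### From oscillation to increments -/

/-- For a monotone function the mean square oscillation over an interval controls the increment over
its middle third. -/
theorem increment_le_of_excess {f F γ : ℝ → ℝ} {M C k t s : ℝ} (hF : Monotone F)
    (hf : ∀ᵐ θ, f θ = F θ - M * θ) (hM : 0 ≤ M) (hC : 0 ≤ C) (hs : 0 < s)
    (hγ : IntervalIntegrable γ volume (t - s) (t + 2 * s))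
    (hi : IntervalIntegrable (fun θ => (f θ - k) ^ 2) volume (t - s) (t + 2 * s))
    (h : ∫ θ in (t - s)..(t + 2 * s), (f θ - k) ^ 2
      ≤ C * (t + 2 * s - (t - s)) * (∫ θ in (t - s)..(t + 2 * s), (1 + |γ θ|)) ^ 2) :
    F (t + s) - F t ≤ (2 * (3 * C + 1) + M) * ∫ θ in (t - s)..(t + 2 * s), (1 + |γ θ|) := by
  have hle : t - s ≤ t + 2 * s := by linarith
  set Λ := ∫ θ in (t - s)..(t + 2 * s), (1 + |γ θ|) with hΛ
  have hsΛ : 3 * s ≤ Λ := by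
    have := intervalIntegral.integral_mono (μ := volume) hle
      (intervalIntegrable_const (c := (1 : ℝ))) (intervalIntegrable_const.add hγ.abs)
      (fun θ => le_add_of_nonneg_right (abs_nonneg (γ θ)))
    rw [intervalIntegral.integral_const, smul_eq_mul, mul_one] at this
    linarith
  have hΛ0 : 0 ≤ Λ := by linarith
  set d := (F (t + s) - F t - 3 * M * s) / 2 with hd
  have hMs : M * (3 * s) ≤ M * Λ := mul_le_mul_of_nonneg_left hsΛ hM
  suffices hdΛ : d ≤ (3 * C + 1) * Λ by
    have : F (t + s) - F t = 2 * d + M * (3 * s) := by rw [hd]; ring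
    rw [this]
    linarith
  rcases le_total d 0 with hd0 | hd0
  · exact hd0.trans (by positivity)
  have hsq : s * d ^ 2 ≤ ∫ θ in (t - s)..(t + 2 * s), (f θ - k) ^ 2 := by
    have hnn : 0 ≤ᵐ[volume.restrict (Ioc (t - s) (t + 2 * s))] fun θ => (f θ - k) ^ 2 :=
      Eventually.of_forall fun θ => sq_nonneg _
    have hcase : d ≤ F (t + s) - M * (t + 2 * s) - k ∨ d ≤ k + M * (t - s) - F t := by
      by_contra! hcon
      rw [hd] at hcon
      linarith [hcon.1, hcon.2]
    rcases hcase with hcase | hcase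
    · refine le_trans ?_ (intervalIntegral.integral_mono_interval (a := t + s) (b := t + 2 * s)
        (by linarith) (by linarith) le_rfl hnn hi)
      have := integral_mono_of_ae_Ioo (a := t + s) (b := t + 2 * s) (by linarith)
        (intervalIntegrable_const (c := d ^ 2)) (hi.mono_set (by
          rw [uIcc_of_le (by linarith), uIcc_of_le hle]; exact Icc_subset_Icc_left (by linarith)))
        (hf.mono fun θ hθ hI => by
          have h1 := hF hI.1.le
          have h2 := mul_le_mul_of_nonneg_left hI.2.le hM
          exact pow_le_pow_left₀ hd0 (by rw [hθ]; linarith) 2)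
      rw [intervalIntegral.integral_const, smul_eq_mul] at this
      linarith
    · refine le_trans ?_ (intervalIntegral.integral_mono_interval (a := t - s) (b := t)
        le_rfl (by linarith) (by linarith) hnn hi)
      have := integral_mono_of_ae_Ioo (a := t - s) (b := t) (by linarith)
        (intervalIntegrable_const (c := d ^ 2)) (hi.mono_set (by
          rw [uIcc_of_le (by linarith), uIcc_of_le hle]; exact Icc_subset_Icc_right (by linarith)))
        (hf.mono fun θ hθ hI => by
          have h1 := hF hI.2.le
          have h2 := mul_le_mul_of_nonneg_left hI.1.le hM
          rw [← neg_sq (f θ - k)]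
          exact pow_le_pow_left₀ hd0 (by rw [hθ]; linarith) 2)
      rw [intervalIntegral.integral_const, smul_eq_mul] at this
      linarith
  have h1 : s * d ^ 2 ≤ s * (3 * C * Λ ^ 2) := by linarith
  have h2 : d ^ 2 ≤ 3 * C * Λ ^ 2 := le_of_mul_le_mul_left h1 hs
  refine (sq_le_sq₀ hd0 (by positivity)).1 ?_
  have h3 : 0 ≤ Λ ^ 2 * (9 * C ^ 2 + 3 * C + 1) := by positivity
  linarith

/-- Subdividing an interval finely, the enlarged pieces cover it three times. -/
theorem increment_le_of_local {F P : ℝ → ℝ} {Ω : Set ℝ} (hΩ : IsOpen Ω) (hP : Continuous P)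
    (hloc : ∀ t s, 0 < s → 3 * s ≤ 1 → Icc (t - s) (t + 2 * s) ⊆ Ω →
      F (t + s) - F t ≤ P (t + 2 * s) - P (t - s)) {x y : ℝ} (hxy : x ≤ y) (h : Icc x y ⊆ Ω) :
    F y - F x ≤ 3 * (P y - P x) := by
  rcases hxy.eq_or_lt with rfl | hlt
  · simp
  obtain ⟨δ, hδ, hsub⟩ := isCompact_Icc.exists_cthickening_subset_open hΩ h
  let s : ℕ → ℝ := fun n => (y - x) * (1 / ((n : ℝ) + 1))
  have hs0 : ∀ n, 0 < s n := fun n => mul_pos (sub_pos.2 hlt) (by positivity)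
  have hs : Tendsto s atTop (𝓝 0) := by
    have := (tendsto_one_div_add_atTop_nhds_zero_nat (𝕜 := ℝ)).const_mul (y - x)
    rwa [mul_zero] at this
  have hlim : Tendsto (fun n => (P (y + s n) - P (x + s n)) + (P y - P x)
      + (P (y - s n) - P (x - s n))) atTop (𝓝 ((P y - P x) + (P y - P x) + (P y - P x))) := by
    have hc : Continuous fun σ : ℝ => (P (y + σ) - P (x + σ)) + (P y - P x)
      + (P (y - σ) - P (x - σ)) := by fun_prop
    have := (hc.tendsto 0).comp hs
    simpa only [Function.comp_def, add_zero, sub_zero] using this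
  have hmain : F y - F x ≤ (P y - P x) + (P y - P x) + (P y - P x) := by
    refine ge_of_tendsto hlim ?_
    filter_upwards [hs.eventually_lt_const hδ,
      hs.eventually_lt_const (show (0 : ℝ) < 1 / 3 by norm_num)] with n h1 h2
    set σ := s n with hσ
    have hσ0 : 0 < σ := hs0 n
    have hend : x + ((n + 1 : ℕ) : ℝ) * σ = y := by
      have : ((n : ℝ) + 1) ≠ 0 := by positivity
      simp only [hσ, s]
      push_cast
      field_simp
      ring
    have tele : ∀ (f : ℝ → ℝ) (c : ℝ), ∑ i ∈ Finset.range (n + 1),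
        (f (x + ((i + 1 : ℕ) : ℝ) * σ + c) - f (x + (i : ℝ) * σ + c)) = f (y + c) - f (x + c) := by
      intro f c
      rw [Finset.sum_range_sub (fun i : ℕ => f (x + (i : ℝ) * σ + c)), hend]
      simp
    have t0 := tele F 0
    have t1 := tele P σ
    have t2 := tele P 0
    have t3 := tele P (-σ)
    simp only [add_zero, ← sub_eq_add_neg] at t0 t1 t2 t3
    rw [← t0, ← t1, ← t2, ← t3, ← Finset.sum_add_distrib, ← Finset.sum_add_distrib]
    refine Finset.sum_le_sum fun i hi => ?_
    have hi' : ((i + 1 : ℕ) : ℝ) ≤ ((n + 1 : ℕ) : ℝ) := by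
      exact_mod_cast Finset.mem_range.1 hi
    have hle : x + ((i + 1 : ℕ) : ℝ) * σ ≤ y := by
      rw [← hend]
      linarith [mul_le_mul_of_nonneg_right hi' hσ0.le]
    have hi0 : 0 ≤ (i : ℝ) * σ := by positivity
    set τ := x + (i : ℝ) * σ with hτ
    have e1 : x + ((i + 1 : ℕ) : ℝ) * σ = τ + σ := by rw [hτ]; push_cast; ring
    rw [e1] at hle ⊢
    have := hloc τ σ hσ0 (by linarith) fun z hz => hsub ?_
    · rw [show τ + σ + σ = τ + 2 * σ by ring, show τ + σ - σ = τ by ring]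
      linarith
    · obtain ⟨w, hw, hw'⟩ := exists_dist_le_of_mem_Icc (m := x) (M := y) (δ := δ) (x := z) hxy hδ.le
        ⟨by linarith [hz.1], by linarith [hz.2]⟩
      exact Metric.mem_cthickening_of_dist_le z w δ _ hw hw'
  linarith


/-! ### Weak derivatives of functions with integrably bounded increments -/

theorem absolutelyContinuousOnInterval_of_dist_le {f W : ℝ → ℝ} {a b δ : ℝ} (hδ : 0 < δ)
    (hW : AbsolutelyContinuousOnInterval W a b)
    (h : ∀ x ∈ uIcc a b, ∀ y ∈ uIcc a b, dist x y < δ → dist (f x) (f y) ≤ dist (W x) (W y)) :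
    AbsolutelyContinuousOnInterval f a b := by
  rw [absolutelyContinuousOnInterval_iff] at hW ⊢
  intro ε hε
  obtain ⟨η, hη, hη'⟩ := hW ε hε
  refine ⟨min η δ, lt_min hη hδ, fun E hE hlen => ?_⟩
  rw [lt_min_iff] at hlen
  refine lt_of_le_of_lt (Finset.sum_le_sum fun i hi => ?_) (hη' E hE hlen.1)
  have hmem := hE.1 i hi
  refine h _ hmem.1 _ hmem.2 (lt_of_le_of_lt ?_ hlen.2)
  exact Finset.single_le_sum (f := fun i => dist (E.2 i).1 (E.2 i).2) (fun i _ => dist_nonneg) hi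

theorem locallyIntegrable_of_intervalIntegrable {h : ℝ → ℝ}
    (hh : ∀ a b, IntervalIntegrable h volume a b) : LocallyIntegrable h volume := fun x =>
  ⟨Ioc (x - 1) (x + 1), Ioc_mem_nhds (by linarith) (by linarith), (hh _ _).1⟩

section

variable {f h : ℝ → ℝ} {Ω : Set ℝ}

theorem ae_abs_deriv_le (hΩ : IsOpen Ω) (hh : ∀ a b, IntervalIntegrable h volume a b)
    (hf : ∀ᵐ x, DifferentiableAt ℝ f x)
    (hle : ∀ x y, x ≤ y → Icc x y ⊆ Ω → |f y - f x| ≤ ∫ s in x..y, h s) :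
    ∀ᵐ x, x ∈ Ω → |deriv f x| ≤ h x := by
  filter_upwards [hf,
    _root_.LocallyIntegrable.ae_hasDerivAt_integral (locallyIntegrable_of_intervalIntegrable hh)] with x hx hx' hxΩ
  have h1 := hx.hasDerivAt.tendsto_slope_zero_right.abs
  have h2 := (hx' x).tendsto_slope_zero_right
  refine le_of_tendsto_of_tendsto h1 h2 ?_
  obtain ⟨ε, hε, hball⟩ := Metric.isOpen_iff.1 hΩ x hxΩ
  filter_upwards [self_mem_nhdsWithin,
    (eventually_lt_nhds hε).filter_mono nhdsWithin_le_nhds] with t ht0 ht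
  have ht0 : 0 < t := ht0
  rw [intervalIntegral.integral_same, sub_zero, smul_eq_mul, smul_eq_mul, abs_mul,
    abs_of_pos (inv_pos.2 ht0)]
  refine mul_le_mul_of_nonneg_left (hle _ _ (by linarith) fun y hy => hball ?_) (by positivity)
  rw [Metric.mem_ball, Real.dist_eq, abs_of_nonneg (by linarith [hy.1])]
  linarith [hy.2]

/-- If the increments of `f` inside the open set `Ω` are controlled by the integral of `h`, then `f`
is locally absolutely continuous there, so that its pointwise derivative is its weak derivative. -/
theorem integral_mul_deriv_of_increment_le (hΩ : IsOpen Ω) (h0 : ∀ x, 0 ≤ h x)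
    (hh : ∀ a b, IntervalIntegrable h volume a b) (hf : ∀ᵐ x, DifferentiableAt ℝ f x)
    (hfi : ∀ a b, IntervalIntegrable f volume a b) (hfb : ∀ R, ∃ B, ∀ x ∈ Icc (-R) R, |f x| ≤ B)
    (hle : ∀ x y, x ≤ y → Icc x y ⊆ Ω → |f y - f x| ≤ ∫ s in x..y, h s)
    {φ : ℝ → ℝ} (hφ : ContDiff ℝ ∞ φ) (hφc : HasCompactSupport φ) (hφΩ : tsupport φ ⊆ Ω) :
    ∫ x, f x * deriv φ x = - ∫ x, deriv f x * φ x := by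
  obtain ⟨L, hL⟩ := hφ.lipschitzWith_of_hasCompactSupport hφc (by simp)
  obtain ⟨Φ, hΦ⟩ := hφc.exists_bound_of_continuous hφ.continuous
  have hΦ0 : 0 ≤ Φ := (norm_nonneg _).trans (hΦ 0)
  obtain ⟨δ, hδ, hsub⟩ := hφc.isCompact.exists_cthickening_subset_open hΩ hφΩ
  obtain ⟨R, hR⟩ := hφc.isCompact.isBounded.subset_ball (0 : ℝ)
  have hball : ∀ x ∈ tsupport φ, -R < x ∧ x < R := by
    intro x hx
    have := hR hx
    rwa [mem_ball_zero_iff, Real.norm_eq_abs, abs_lt] at this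
  have hout : ∀ x, x ∉ tsupport φ → φ x = 0 := fun x hx => image_eq_zero_of_notMem_tsupport hx
  have hφR : φ R = 0 := hout R fun hx => (hball R hx).2.false
  have hφR' : φ (-R) = 0 := hout (-R) fun hx => (hball (-R) hx).1.false
  obtain ⟨B, hB⟩ := hfb |R|
  have hsubR : uIcc (-R) R ⊆ Icc (-|R|) |R| :=
    uIcc_subset_Icc ⟨neg_le_neg (le_abs_self R), (neg_le_abs R)⟩ ⟨neg_abs_le R, le_abs_self R⟩
  set W : ℝ → ℝ := fun x => B * L * x + Φ * ∫ s in (-R)..x, h s with hW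
  have hWac : AbsolutelyContinuousOnInterval W (-R) R := by
    have h1 : AbsolutelyContinuousOnInterval (fun x : ℝ => x) (-R) R :=
      ((LipschitzWith.id (α := ℝ)).lipschitzOnWith (s := uIcc (-R) R)).absolutelyContinuousOnInterval
    exact (h1.const_mul (B * L)).add
      (((hh (-R) R).absolutelyContinuousOnInterval_intervalIntegral left_mem_uIcc).const_mul Φ)
  have hstep : ∀ x ∈ uIcc (-R) R, ∀ y ∈ uIcc (-R) R, x ≤ y → dist x y < δ →
      dist (f x * φ x) (f y * φ y) ≤ dist (W x) (W y) := by
    intro x hx y hy hxy hd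
    have hI0 : 0 ≤ ∫ s in x..y, h s := intervalIntegral.integral_nonneg hxy fun s _ => h0 s
    have hB0 : 0 ≤ B := (abs_nonneg _).trans (hB y (hsubR hy))
    have hWd : W y - W x = B * L * (y - x) + Φ * ∫ s in x..y, h s := by
      simp only [hW]
      rw [← intervalIntegral.integral_interval_sub_left (hh (-R) y) (hh (-R) x)]
      ring
    have hyx : 0 ≤ y - x := sub_nonneg.2 hxy
    rw [dist_comm (W x), Real.dist_eq (W y), hWd, abs_of_nonneg (by positivity)]
    by_cases hsupp : x ∈ tsupport φ ∨ y ∈ tsupport φ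
    · have hI : Icc x y ⊆ Ω := by
        intro z hz
        rw [dist_comm, Real.dist_eq, abs_of_nonneg hyx] at hd
        refine hsub ?_
        rcases hsupp with hs | hs
        · refine Metric.mem_cthickening_of_dist_le z x δ _ hs ?_
          rw [Real.dist_eq, abs_of_nonneg (by linarith [hz.1])]
          linarith [hz.2]
        · refine Metric.mem_cthickening_of_dist_le z y δ _ hs ?_
          rw [dist_comm, Real.dist_eq, abs_of_nonneg (by linarith [hz.2])]
          linarith [hz.1]
      have h1 := hle x y hxy hI
      have h2 : |φ y - φ x| ≤ L * (y - x) := by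
        have := hL.dist_le_mul y x
        rwa [Real.dist_eq, Real.dist_eq, abs_of_nonneg hyx] at this
      rw [dist_comm, Real.dist_eq,
        show f y * φ y - f x * φ x = f y * (φ y - φ x) + φ x * (f y - f x) by ring]
      refine (abs_add_le _ _).trans ?_
      rw [abs_mul, abs_mul, mul_assoc]
      exact add_le_add (mul_le_mul (hB y (hsubR hy)) h2 (abs_nonneg _) hB0)
        (mul_le_mul (hΦ x) h1 (abs_nonneg _) hΦ0)
    · push Not at hsupp
      rw [hout x hsupp.1, hout y hsupp.2, mul_zero, mul_zero, dist_self]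
      positivity
  have hac : AbsolutelyContinuousOnInterval (fun x => f x * φ x) (-R) R := by
    refine absolutelyContinuousOnInterval_of_dist_le hδ hWac fun x hx y hy hd => ?_
    rcases le_total x y with hxy | hxy
    · exact hstep x hx y hy hxy hd
    · rw [dist_comm (f x * φ x), dist_comm (W x)]
      exact hstep y hy x hx hxy (dist_comm x y ▸ hd)
  have hzero := hac.integral_deriv_eq_sub
  rw [hφR, hφR', mul_zero, mul_zero, sub_zero] at hzero
  have hφ' : Continuous (deriv φ) := hφ.continuous_deriv (by simp)
  have hi1 : IntervalIntegrable (fun x => f x * deriv φ x) volume (-R) R :=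
    (hfi _ _).mul_continuousOn hφ'.continuousOn
  have hae : ∀ᵐ x, deriv f x * φ x = deriv (fun x => f x * φ x) x - f x * deriv φ x := by
    filter_upwards [hf] with x hx
    rw [deriv_fun_mul hx (hφ.differentiable (by simp) x)]
    ring
  have hparts : ∫ x in (-R)..R, deriv f x * φ x = - ∫ x in (-R)..R, f x * deriv φ x := by
    rw [intervalIntegral.integral_congr_ae (hae.mono fun x hx _ => hx),
      intervalIntegral.integral_sub hac.intervalIntegrable_deriv hi1, hzero, zero_sub]
  have hs1 : Function.support (fun x => f x * deriv φ x) ⊆ Ioc (-R) R := by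
    intro x hx
    have : x ∈ tsupport φ := support_deriv_subset (right_ne_zero_of_mul hx)
    exact ⟨(hball x this).1, (hball x this).2.le⟩
  have hs2 : Function.support (fun x => deriv f x * φ x) ⊆ Ioc (-R) R := by
    intro x hx
    have : x ∈ tsupport φ := subset_tsupport _ (right_ne_zero_of_mul hx)
    exact ⟨(hball x this).1, (hball x this).2.le⟩
  rw [← intervalIntegral.integral_eq_integral_of_support_subset hs1,
    ← intervalIntegral.integral_eq_integral_of_support_subset hs2, hparts, neg_neg]

end

theorem isOpen_Tin {k₁ k₂ : ℝ → ℝ≥0∞} (hk₁ : UpperSemicontinuous k₁) (hk₂ : LowerSemicontinuous k₂)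
    (u : W1) : IsOpen (Tin k₁ k₂ u) := by
  have hc : Continuous fun θ => ENNReal.ofReal (u θ) :=
    ENNReal.continuous_ofReal.comp u.continuous
  rw [isOpen_iff_mem_nhds]
  rintro θ ⟨h1, h2⟩
  obtain ⟨c, hc1, hc2⟩ := exists_between h1
  obtain ⟨d, hd1, hd2⟩ := exists_between h2
  filter_upwards [hk₁ θ c hc1, hk₂ θ d hd2, hc.continuousAt.eventually_const_lt hc2,
    hc.continuousAt.eventually_lt_const hd1] with y y1 y2 y3 y4
  exact ⟨y1.trans y3, y4.trans y2⟩

end GaugeReg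

open GaugeReg in
theorem theorem2p1
    (k₁ k₂ : ℝ → ℝ≥0∞)
    (hk₁ : UpperSemicontinuous k₁) (hk₂ : LowerSemicontinuous k₂)
    (hk₁p : Function.Periodic k₁ (2 * Real.pi)) (hk₂p : Function.Periodic k₂ (2 * Real.pi))
    (r : W1 → ℝ) (G : ℝ × ℝ × ℝ → ℝ)
    (hGp : ∀ θ x q : ℝ, 0 < x → G (θ + 2 * Real.pi, x, q) = G (θ, x, q))
    (u₀ : W1) (hu₀ : IsOptimal r G k₁ k₂ u₀)
    (hr : ContDiffAt ℝ 1 r u₀)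
    (hG : ∃ U : Set (ℝ × ℝ × ℝ), IsOpen U ∧ graphBox u₀ ⊆ U ∧ ContDiffOn ℝ 2 G U)
    (p : ℝ≥0∞) (hp : 1 ≤ p)
    (hrp : ∃ g : ℝ → ℝ, MemLp g p (volume.restrict (Ico 0 (2 * Real.pi))) ∧
      ∀ v : W1, fderiv ℝ r u₀ v = ∫ θ in (0 : ℝ)..(2 * Real.pi), g θ * v θ)
    (hGqq : ∀ θ x q : ℝ, (θ, x, q) ∈ graphBox u₀ →
      0 < iteratedDeriv 2 (fun s : ℝ => G (θ, x, s)) q) :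
    MemW2 p (Tin k₁ k₂ u₀) u₀ := by
  obtain ⟨U, hU, hGU, hG⟩ := hG
  obtain ⟨g, hg, hgr⟩ := hrp
  obtain ⟨γ, hγp, hγ, hγi⟩ := exists_periodic_extension hp hg
  obtain ⟨C, hC, hexc⟩ := hu₀.exists_excess_bound hk₂ hk₁p hk₂p hGp
    (hr.differentiableAt one_ne_zero) hU hGU hG hGqq hγp hγ hγi hgr
  obtain ⟨m, M, -, hrange⟩ := u₀.exists_range_eq
  have h0 : ∀ θ, 0 ≤ u₀ θ := fun θ => (hu₀.1 θ).2.2.le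
  have hM : ∀ θ, u₀ θ ≤ M := fun θ => (hrange ▸ mem_range_self θ : u₀ θ ∈ Icc m M).2
  have hM0 : 0 ≤ M := (h0 0).trans (hM 0)
  obtain ⟨F, hF, hFu⟩ := hu₀.2.1.exists_monotone h0 hM
  set Ω := Tin k₁ k₂ u₀ with hΩdef
  have hΩ : IsOpen Ω := isOpen_Tin hk₁ hk₂ u₀
  set C' := 2 * (3 * C + 1) + M with hC'
  have hC'0 : 0 ≤ C' := by positivity
  have hi : ∀ a b, IntervalIntegrable (fun θ => 1 + |γ θ|) volume a b := fun a b =>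
    intervalIntegrable_const.add (hγi a b).abs
  set P : ℝ → ℝ := fun x => C' * ∫ θ in (0 : ℝ)..x, (1 + |γ θ|) with hP
  have hPsub : ∀ x y, P y - P x = C' * ∫ θ in x..y, (1 + |γ θ|) := by
    intro x y
    simp only [hP]
    rw [← mul_sub, intervalIntegral.integral_interval_sub_left (hi 0 y) (hi 0 x)]
  have hPc : Continuous P := continuous_const.mul (intervalIntegral.continuous_primitive hi 0)
  have hincr : ∀ x y, x ≤ y → Icc x y ⊆ Ω → F y - F x ≤ 3 * (P y - P x) := by
    intro x y hxy hsub
    refine increment_le_of_local hΩ hPc (fun t s hs hs1 hJ => ?_) hxy hsub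
    rw [hPsub]
    exact increment_le_of_excess hF hFu hM0 hC hs (hγi _ _) (intervalIntegrable_deriv_sub_sq _ _ _ _)
      (hexc _ _ (by linarith) (by linarith) hJ)
  set f : ℝ → ℝ := fun θ => F θ - M * θ with hf
  set h : ℝ → ℝ := fun θ => 3 * C' * (1 + |γ θ|) + M with hh
  have h_nonneg : ∀ θ, 0 ≤ h θ := fun θ => by positivity
  have hhi : ∀ a b, IntervalIntegrable h volume a b := fun a b =>
    ((hi a b).const_mul _).add intervalIntegrable_const
  have hle : ∀ x y, x ≤ y → Icc x y ⊆ Ω → |f y - f x| ≤ ∫ s in x..y, h s := by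
    intro x y hxy hsub
    have e1 := hincr x y hxy hsub
    have e2 := hF hxy
    have e3 := mul_le_mul_of_nonneg_left hxy hM0
    rw [hPsub] at e1
    have e4 : ∫ s in x..y, h s = 3 * C' * (∫ θ in x..y, (1 + |γ θ|)) + (y - x) * M := by
      rw [intervalIntegral.integral_add ((hi x y).const_mul _) intervalIntegrable_const,
        intervalIntegral.integral_const_mul, intervalIntegral.integral_const, smul_eq_mul]
    rw [e4]
    have e5 : 0 ≤ 3 * C' * (∫ θ in x..y, (1 + |γ θ|)) :=
      mul_nonneg (by positivity) (intervalIntegral.integral_nonneg hxy fun θ _ => by positivity)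
    simp only [hf]
    rw [abs_le]
    constructor <;> linarith
  have hfd : ∀ᵐ x, DifferentiableAt ℝ f x :=
    hF.ae_differentiableAt.mono fun x hx => hx.sub (differentiableAt_id.const_mul M)
  have hfi : ∀ a b, IntervalIntegrable f volume a b := fun a b =>
    (hF.intervalIntegrable).sub ((continuous_const.mul continuous_id).intervalIntegrable _ _)
  have hfb : ∀ R, ∃ B, ∀ x ∈ Icc (-R) R, |f x| ≤ B := by
    intro R
    refine ⟨max |F (-R)| |F R| + M * R, fun x hx => (abs_sub _ _).trans (add_le_add ?_ ?_)⟩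
    · exact abs_le_max_abs_abs (hF hx.1) (hF hx.2)
    · rw [abs_mul, abs_of_nonneg hM0]
      exact mul_le_mul_of_nonneg_left (abs_le.2 hx) hM0
  have hbound := ae_abs_deriv_le hΩ hhi hfd hle
  -- Cutting `f'` off outside `𝕋_in` makes it locally integrable on the whole line.
  set f₂ : ℝ → ℝ := Ω.indicator (deriv f) with hf₂
  have hf₂m : AEStronglyMeasurable f₂ volume :=
    ((measurable_deriv f).indicator hΩ.measurableSet).aestronglyMeasurable
  have hf₂h : ∀ᵐ θ, ‖f₂ θ‖ ≤ ‖h θ‖ := by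
    filter_upwards [hbound] with θ hθ
    rw [Real.norm_of_nonneg (h_nonneg θ), Real.norm_eq_abs]
    by_cases hmem : θ ∈ Ω
    · simpa only [hf₂, indicator_of_mem hmem] using hθ hmem
    · simpa only [hf₂, indicator_of_notMem hmem, abs_zero] using h_nonneg θ
  have hf₂i : LocallyIntegrable f₂ volume :=
    (locallyIntegrable_of_intervalIntegrable hhi).mono hf₂m hf₂h
  obtain ⟨Cu, hCu⟩ := u₀.exists_lipschitz
  obtain ⟨w1, w2, w3⟩ := hasWeakDerivOn_of_lipschitz hCu
  have hfin : IsFiniteMeasure (volume.restrict (Ω ∩ Ico 0 (2 * Real.pi))) :=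
    isFiniteMeasure_restrict.2 (measure_ne_top_of_subset inter_subset_right measure_Ico_lt_top.ne)
  have hmono : volume.restrict (Ω ∩ Ico 0 (2 * Real.pi)) ≤ volume.restrict (Ico 0 (2 * Real.pi)) :=
    Measure.restrict_mono inter_subset_right le_rfl
  refine ⟨deriv u₀, f₂, ⟨w1.mono_set (subset_univ _), w2.mono_set (subset_univ _),
    fun φ hφ hφc _ => w3 φ hφ hφc (subset_univ _)⟩,
    ⟨w2.mono_set (subset_univ _), hf₂i.locallyIntegrableOn _, fun φ hφ hφc hφΩ => ?_⟩,
    (u₀.memLp.restrict _).mono_exponent le_top, (u₀.memLp_deriv.restrict _).mono_exponent le_top, ?_⟩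
  · have e1 : ∫ θ, deriv u₀ θ * deriv φ θ = ∫ θ, f θ * deriv φ θ :=
      integral_congr_ae (hFu.mono fun θ hθ => by simp only [hθ, hf])
    have e2 : ∀ θ, f₂ θ * φ θ = deriv f θ * φ θ := by
      intro θ
      by_cases hmem : θ ∈ Ω
      · rw [hf₂, indicator_of_mem hmem]
      · rw [image_eq_zero_of_notMem_tsupport fun hθ => hmem (hφΩ hθ), mul_zero, mul_zero]
    simp_rw [e1, e2]
    exact integral_mul_deriv_of_increment_le hΩ h_nonneg hhi hfd hfi hfb hle hφ hφc hφΩ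
  · have hγL : MemLp γ p (volume.restrict (Ω ∩ Ico 0 (2 * Real.pi))) :=
      ((memLp_congr_ae hγ).2 hg).mono_measure hmono
    have h1L : MemLp (fun θ => 1 + |γ θ|) p (volume.restrict (Ω ∩ Ico 0 (2 * Real.pi))) :=
      (memLp_const (1 : ℝ)).add hγL.abs
    have hhL : MemLp h p (volume.restrict (Ω ∩ Ico 0 (2 * Real.pi))) :=
      (h1L.const_mul (3 * C')).add (memLp_const M)
    exact hhL.mono hf₂m.restrict (ae_restrict_of_ae hf₂h)
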